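/- Let $P$ be a probability measure, $s_n=1/\sqrt n$, and let $\|\cdot\|$, $\langle\cdot|\cdot\rangle$ be the norm and inner product of $L_2(P)$. Let $G_0,G_1\subset\{g\in L_2(P):\int g\,dP=0\}$ be nonempty, disjoint, closed and convex, and assume that $G_{10}:=G_1-G_0=\{g_1-g_0: g_0\in G_0,\ g_1\in G_1\}$ is closed. For every $g\in G_0\cup G_1$ let $(P_{n,g})_n$ be any sequence of probability measures such that $$\sqrt{dP_{n,g}}=\bigl(1+\tfrac{s_n}{2}\,g\bigr)\sqrt{dP}+o(s_n)\qquad(n\to\infty)$$ in the Hilbert space of square roots of measures. Let $\Phi$ be the standard normal distribution function, let $\alpha\in(0,1)$, and let $u_\alpha$ be given by $\Phi(-u_\alpha)=\alpha$. A test is a sequence $\delta=(\delta_n)$ of measurable functions $\delta_n$ of $n$ observations with values in $[0,1]$. The maxmin asymptotic testing problem $H_{G_0}$ vs. $K_{G_1}$ at level $\alpha$ is to maximize $\inf_{g_1\in G_1}\liminf_{n}\int\delta_n\,dP_{n,g_1}^n$ over all tests $\delta$ such that $\sup_{g_0\in G_0}\limsup_{n}\int\delta_n\,dP_{n,g_0}^n\le\alpha$;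 the maximum is called the maxmin asymptotic power. For a pair $g=(g_0,g_1)\in G_0\times G_1$ and a test $\delta$ put $W(g,\delta)=\liminf_n\int\delta_n\,dP_{n,g_1}^n$ if $\limsup_n\int\delta_n\,dP_{n,g_0}^n\le\alpha$, and $W(g,\delta)=-\infty$ otherwise. A saddle point of the problem is a pair $(g,\delta)$, with $g\in G_0\times G_1$ and $\delta$ a test, such that $$W(g,\delta')\le W(g,\delta)\le W(h,\delta)\qquad\text{for all tests }\delta'\text{ and all }h\in G_0\times G_1 .$$ For $g=(g_0,g_1)\in G_0\times G_1$ write $g_{10}=g_1-g_0$, and let $\delta_g=(\delta_{n,g})$ be the test $$\delta_{n,g}(x_1,\dots,x_n)=\mathbf 1\Bigl(s_n\sum_{i=1}^n g_{10}(x_i)>\|g_{10}\|\,u_\alpha+\langle g_{10}|g_0\rangle\Bigr),$$ where a fixed measurable representative is used for each element of $L_2(P)$. Then $G_{10}$ has a unique element of minimum norm. Let $q=(q_0,q_1)\in G_0\times G_1$ be any pair such that $q_{10}=q_1-q_0$ is this element. Then $(q,\delta_q)$ is a saddle point of the maxmin asymptotic testing problem $H_{G_0}$ vs. $K_{G_1}$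 at level $\alpha$; the maxmin asymptotic power is $\Phi(-u_\alpha+\|q_{10}\|)$, and it is attained by $\delta_q$. For any other pair $g=(g_0,g_1)\in G_0\times G_1$ with $g_{10}=q_{10}$, also $(g,\delta_g)$ is a saddle point, and necessarily $\delta_g=\delta_q$. -/

import Mathlib

open MeasureTheory ProbabilityTheory Filter Topology
open scoped Pointwise

namespace AsympTest

variable {Ω : Type*} [MeasurableSpace Ω]

/-- Tangents at `P`: the elements of `L₂(P)` with expectation zero. -/
def tangents (P : Measure Ω) : Set (Lp ℝ 2 P) :=
  {g | ∫ x, g x ∂P = 0}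

/-- The scale `s_n = 1 / √n`. -/
noncomputable def scale (n : ℕ) : ℝ := 1 / √(n : ℝ)

/-- The squared Hilbert space distance `∫ (√dQ - (1 + (s/2) g) √dP)²` between the square roots of
measures. By the Lebesgue decomposition `dQ = f dP + dQ'`, with `Q'` singular to `P`, it equals
`∫ (√f - (1 + (s/2) g))² dP + Q'(Ω)`. -/
noncomputable def rootDistSq (P Q : Measure Ω) (g : Lp ℝ 2 P) (s : ℝ) : ℝ :=
  ∫ x, (√((Q.rnDeriv P x).toReal) - (1 + s / 2 * g x)) ^ 2 ∂P + (Q.singularPart P).real Set.univ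

/-- `dQ_n ≈ (1 + s_n g) dP`, that is `√dQ_n = (1 + (s_n/2) g) √dP + o(s_n)` in the Hilbert space
of square roots of measures: the distance, divided by `s_n`, tends to zero. -/
def IsLocalAlternative (P : Measure Ω) (g : Lp ℝ 2 P) (Q : ℕ → ProbabilityMeasure Ω) : Prop :=
  Tendsto (fun n : ℕ => rootDistSq P (Q n : Measure Ω) g (scale n) / scale n ^ 2) atTop (𝓝 0)

/-- A sequence of (randomized) tests, `δ n` being a test at sample size `n`. -/
def IsTest (δ : (n : ℕ) → (Fin n → Ω) → ℝ) : Prop :=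
  ∀ n, Measurable (δ n) ∧ ∀ x, δ n x ∈ Set.Icc (0 : ℝ) 1

/-- `∫ δ_n dQ_n^n`. -/
noncomputable def rejectionProb (Q : ℕ → ProbabilityMeasure Ω) (δ : (n : ℕ) → (Fin n → Ω) → ℝ)
    (n : ℕ) : ℝ :=
  ∫ x, δ n x ∂(Measure.pi fun _ : Fin n => (Q n : Measure Ω))

/-- Asymptotic size `limsup_n ∫ δ_n dQ_n^n` under one sequence of alternatives. -/
noncomputable def asympSize (Q : ℕ → ProbabilityMeasure Ω)
    (δ : (n : ℕ) → (Fin n → Ω) → ℝ) : ℝ :=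
  limsup (rejectionProb Q δ) atTop

/-- Asymptotic power `liminf_n ∫ δ_n dQ_n^n` under one sequence of alternatives. -/
noncomputable def asympPower (Q : ℕ → ProbabilityMeasure Ω)
    (δ : (n : ℕ) → (Fin n → Ω) → ℝ) : ℝ :=
  liminf (rejectionProb Q δ) atTop

/-- `sup_{g₀ ∈ G₀} limsup_n ∫ δ_n dP_{n,g₀}^n`. -/
noncomputable def maxSize {P : Measure Ω} (Q : Lp ℝ 2 P → ℕ → ProbabilityMeasure Ω)
    (G₀ : Set (Lp ℝ 2 P)) (δ : (n : ℕ) → (Fin n → Ω) → ℝ) : ℝ :=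
  ⨆ g₀ : G₀, asympSize (Q g₀) δ

/-- `inf_{g₁ ∈ G₁} liminf_n ∫ δ_n dP_{n,g₁}^n`. -/
noncomputable def minPower {P : Measure Ω} (Q : Lp ℝ 2 P → ℕ → ProbabilityMeasure Ω)
    (G₁ : Set (Lp ℝ 2 P)) (δ : (n : ℕ) → (Fin n → Ω) → ℝ) : ℝ :=
  ⨅ g₁ : G₁, asympPower (Q g₁) δ

/-- The tests admitted in the maxmin problem `H_{G₀}` vs. `K_{G₁}` at level `α`. -/
def levelTests {P : Measure Ω} (α : ℝ) (Q : Lp ℝ 2 P → ℕ → ProbabilityMeasure Ω)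
    (G₀ : Set (Lp ℝ 2 P)) : Set ((n : ℕ) → (Fin n → Ω) → ℝ) :=
  {δ | IsTest δ ∧ maxSize Q G₀ δ ≤ α}

/-- The objective of the simple problem `H_{g₀}` vs. `K_{g₁}` at level `α`, with the side condition
on the size built in: `liminf_n ∫ δ_n dP_{n,g₁}^n` if `limsup_n ∫ δ_n dP_{n,g₀}^n ≤ α`, and `-∞`
otherwise. -/
noncomputable def payoff {P : Measure Ω} (α : ℝ) (Q : Lp ℝ 2 P → ℕ → ProbabilityMeasure Ω)
    (g : Lp ℝ 2 P × Lp ℝ 2 P) (δ : (n : ℕ) → (Fin n → Ω) → ℝ) : EReal :=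
  if asympSize (Q g.1) δ ≤ α then ((asympPower (Q g.2) δ : ℝ) : EReal) else ⊥

/-- `(g, δ)` is a saddle point of the maxmin problem `H_{G₀}` vs. `K_{G₁}` at level `α`: for all
pairs `h ∈ G₀ × G₁` and all tests `δ'`, `payoff g δ' ≤ payoff g δ ≤ payoff h δ`. -/
def IsSaddle {P : Measure Ω} (α : ℝ) (Q : Lp ℝ 2 P → ℕ → ProbabilityMeasure Ω)
    (G₀ G₁ : Set (Lp ℝ 2 P)) (g : Lp ℝ 2 P × Lp ℝ 2 P) (δ : (n : ℕ) → (Fin n → Ω) → ℝ) : Prop :=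
  g ∈ G₀ ×ˢ G₁ ∧ IsTest δ ∧ IsSaddlePointOn (G₀ ×ˢ G₁) {δ' | IsTest δ'} (payoff α Q) g δ

/-- The standard normal distribution function `Φ`. -/
noncomputable def Phi (t : ℝ) : ℝ := cdf (gaussianReal 0 1) t

/-- The test `δ_g` with critical point `u`, for `g = (g₀, g₁)` and `g₁₀ = g₁ - g₀`:
`δ_{n,g} = 1 (s_n ∑ g₁₀(x_i) > ‖g₁₀‖ u + ⟨g₁₀|g₀⟩)`. -/
noncomputable def optTest {P : Measure Ω} (u : ℝ) (g : Lp ℝ 2 P × Lp ℝ 2 P) (n : ℕ)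
    (x : Fin n → Ω) : ℝ :=
  if scale n * ∑ i, (g.2 - g.1) (x i) > ‖g.2 - g.1‖ * u + inner ℝ (g.2 - g.1) g.1 then 1 else 0

/-- `h` is an element of minimum norm of `G`. -/
def IsMinNorm {P : Measure Ω} (G : Set (Lp ℝ 2 P)) (h : Lp ℝ 2 P) : Prop :=
  h ∈ G ∧ ∀ k ∈ G, ‖h‖ ≤ ‖k‖

end AsympTest

set_option linter.unusedSectionVars false

namespace AsympTest

variable {Ω : Type*} [MeasurableSpace Ω]

/-! ### Product measures -/

/-! The pair `q` is least favourable. Under local alternatives with tangent `g`, the statistic `s_n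
∑ q₁₀(x_i)` is asymptotically normal with mean `⟨q₁₀|g⟩` and variance `‖q₁₀‖²`, so the power of
`δ_q` tends to `Φ(-u + ⟨q₁₀|g - q₀⟩ / ‖q₁₀‖)`. Since `q₁₀` is the projection of `0` onto the convex
set `G₁ - G₀`, the variational inequality `⟨q₁₀|k - q₁₀⟩ ≥ 0` makes this limit at most `Φ(-u)` on
`G₀` and at least `Φ(-u + ‖q₁₀‖)` on `G₁`. Conversely, no test of asymptotic level `Φ(-u)` for `q₀`
against `q₁` alone has larger asymptotic power than `Φ(-u + ‖q₁₀‖)` (`asympPower_le`). The two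
bounds meet, which gives both the saddle point and the maxmin value.

The upper bound rests on three facts. Sequences of laws with the same tangent are indistinguishable
by tests, uniformly over all tests, because the `n`th power of their Hellinger affinity tends to 1
(`IsLocalAlternative.exists_abs_sub_le`). Hence the given laws may be replaced by exponential tilts
of `P` along truncated tangents (`isLocalAlternative_tilt`). For these the log likelihood ratio is,
up to a constant, the statistic of a sum test, so the Neyman–Pearson lemma applies at every `n`
(`rejectionProb_tilt_le`).

Both halves use one limit theorem, `tendsto_rejectionProb_sumTest`, in which the summand `k_n` may
vary with `n`: it is constant for `δ_q` and a truncated difference for the upper bound. It is proved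
by characteristic functions directly under the local alternatives, expanding the root density as `1
+ s_n g / 2` plus an error of order `o(s_n)`. -/

theorem pi_mono_measure {ι : Type*} [Fintype ι] {μ ν : Measure Ω}
    (h : μ ≤ ν) : Measure.pi (fun _ : ι => μ) ≤ Measure.pi (fun _ : ι => ν) := by
  refine Measure.le_iff.2 fun s hs => ?_
  simp only [Measure.pi, toMeasure_apply _ _ hs]
  have : OuterMeasure.pi (fun _ : ι => μ.toOuterMeasure) ≤
      OuterMeasure.pi (fun _ : ι => ν.toOuterMeasure) := by
    refine OuterMeasure.le_pi.2 fun t _ => (OuterMeasure.pi_pi_le _ t).trans ?_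
    exact Finset.prod_le_prod' fun i _ => h (t i)
  exact this s

theorem pi_withDensity_ofReal {ι : Type*} [Fintype ι] {μ : Measure Ω} [SigmaFinite μ] {f : Ω → ℝ}
    (hf : Integrable f μ) (h0 : 0 ≤ f) :
    Measure.pi (fun _ : ι => μ.withDensity fun x => ENNReal.ofReal (f x)) =
      (Measure.pi fun _ : ι => μ).withDensity fun x => ENNReal.ofReal (∏ i, f (x i)) := by
  have : IsFiniteMeasure (μ.withDensity fun x => ENNReal.ofReal (f x)) :=
    isFiniteMeasure_withDensity_ofReal hf.2
  refine Measure.pi_eq fun s hs => ?_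
  rw [withDensity_apply _ (MeasurableSet.univ_pi hs), Measure.restrict_pi_pi,
    ← ofReal_integral_eq_lintegral_ofReal (Integrable.fintype_prod fun i => hf.restrict)
      (Eventually.of_forall fun x => Finset.prod_nonneg fun i _ => h0 (x i)),
    integral_fintype_prod_eq_prod (fun _ => f),
    ENNReal.ofReal_prod_of_nonneg fun i _ => integral_nonneg h0]
  refine Finset.prod_congr rfl fun i _ => ?_
  rw [withDensity_apply _ (hs i), ofReal_integral_eq_lintegral_ofReal hf.restrict
    (Eventually.of_forall h0)]

theorem integral_withDensity_ofReal {μ : Measure Ω} {f : Ω → ℝ} (hf : Measurable f)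
    (h0 : 0 ≤ f) {E : Type*} [NormedAddCommGroup E] [NormedSpace ℝ E] (g : Ω → E) :
    ∫ x, g x ∂(μ.withDensity fun x => ENNReal.ofReal (f x)) = ∫ x, f x • g x ∂μ := by
  rw [integral_withDensity_eq_integral_toReal_smul hf.ennreal_ofReal
    (Eventually.of_forall fun x => ENNReal.ofReal_lt_top)]
  simp only [ENNReal.toReal_ofReal (h0 _)]

theorem abs_integral_mul_le {μ : Measure Ω} {f g : Ω → ℝ} (hf : MemLp f 2 μ) (hg : MemLp g 2 μ) :
    ∫ x, |f x * g x| ∂μ ≤ √(∫ x, f x ^ 2 ∂μ) * √(∫ x, g x ^ 2 ∂μ) := by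
  have := integral_mul_norm_le_Lp_mul_Lq (μ := μ) (f := f) (g := g) Real.HolderConjugate.two_two
    (by simpa using hf) (by simpa using hg)
  simpa [Real.sqrt_eq_rpow, abs_mul] using this

/-- The square root of the density of `Q` with respect to `P`. -/
noncomputable def rootDensity (P Q : Measure Ω) (x : Ω) : ℝ := √((Q.rnDeriv P x).toReal)

theorem measurable_rootDensity (P Q : Measure Ω) : Measurable (rootDensity P Q) :=
  (Measure.measurable_rnDeriv Q P).ennreal_toReal.sqrt

theorem rootDensity_nonneg (P Q : Measure Ω) (x : Ω) : 0 ≤ rootDensity P Q x := Real.sqrt_nonneg _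

theorem rootDensity_sq (P Q : Measure Ω) (x : Ω) :
    rootDensity P Q x ^ 2 = (Q.rnDeriv P x).toReal := Real.sq_sqrt ENNReal.toReal_nonneg

theorem integrable_rootDensity_sq (P Q : Measure Ω) [IsFiniteMeasure Q] :
    Integrable (fun x => rootDensity P Q x ^ 2) P := by
  simpa only [rootDensity_sq] using Measure.integrable_toReal_rnDeriv

theorem memLp_rootDensity (P Q : Measure Ω) [IsFiniteMeasure Q] :
    MemLp (rootDensity P Q) 2 P :=
  (memLp_two_iff_integrable_sq (measurable_rootDensity P Q).aestronglyMeasurable).2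
    (integrable_rootDensity_sq P Q)

theorem withDensity_rootDensity (P Q : Measure Ω) [SigmaFinite Q] :
    (P.withDensity fun x => ENNReal.ofReal (rootDensity P Q x ^ 2)) =
      P.withDensity (Q.rnDeriv P) := by
  refine withDensity_congr_ae ?_
  filter_upwards [Measure.rnDeriv_lt_top Q P] with x hx
  rw [rootDensity_sq, ENNReal.ofReal_toReal hx.ne]

theorem integral_rootDensity_sq (P Q : Measure Ω) [IsProbabilityMeasure P]
    [IsProbabilityMeasure Q] :
    ∫ x, rootDensity P Q x ^ 2 ∂P = 1 - (Q.singularPart P).real Set.univ := by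
  simp only [rootDensity_sq, Measure.integral_toReal_rnDeriv', probReal_univ]

/-! ### Hellinger affinity and the power of tests -/

section Hellinger

variable {n : ℕ} {P : Measure Ω} [IsProbabilityMeasure P]

theorem integral_test_mul_prod_eq (Q : Measure Ω) [IsProbabilityMeasure Q]
    (δ : (Fin n → Ω) → ℝ) :
    ∫ x, δ x ∂(Measure.pi fun _ : Fin n => P.withDensity (Q.rnDeriv P)) =
      ∫ x, (∏ i, rootDensity P Q (x i)) ^ 2 * δ x ∂(Measure.pi fun _ : Fin n => P) := by
  rw [← withDensity_rootDensity, pi_withDensity_ofReal (integrable_rootDensity_sq P Q)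
    (fun x => sq_nonneg _), integral_withDensity_ofReal]
  · simp [Finset.prod_pow]
  · have := measurable_rootDensity P Q
    fun_prop
  · exact fun x => Finset.prod_nonneg fun i _ => sq_nonneg _

/-- `Q` may have a part singular to `P`, and dropping it can only decrease the integral of a
nonnegative test. One direction suffices, since `Q` enters `integral_test_sub_le` with a minus sign.
-/
theorem integral_test_mul_prod_le (Q : Measure Ω) [IsProbabilityMeasure Q]
    {δ : (Fin n → Ω) → ℝ} (hδ : Measurable δ) (h01 : ∀ x, δ x ∈ Set.Icc (0 : ℝ) 1) :
    ∫ x, (∏ i, rootDensity P Q (x i)) ^ 2 * δ x ∂(Measure.pi fun _ : Fin n => P) ≤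
      ∫ x, δ x ∂(Measure.pi fun _ : Fin n => Q) := by
  rw [← integral_test_mul_prod_eq]
  refine integral_mono_measure (pi_mono_measure (Measure.withDensity_rnDeriv_le Q P))
    (Eventually.of_forall fun x => (h01 x).1) ?_
  exact Integrable.of_bound hδ.aestronglyMeasurable 1
    (Eventually.of_forall fun x => by rw [Real.norm_eq_abs, abs_le]; constructor <;>
      linarith [(h01 x).1, (h01 x).2])

theorem integral_prod_mul_prod {f g : Ω → ℝ} :
    ∫ x, (∏ i, f (x i)) * (∏ i, g (x i)) ∂(Measure.pi fun _ : Fin n => P) =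
      (∫ x, f x * g x ∂P) ^ n := by
  simp only [← Finset.prod_mul_distrib]
  simpa using integral_fintype_prod_eq_pow (ι := Fin n) (μ := P) (fun x => f x * g x)

theorem memLp_prod {f : Ω → ℝ} (hf : MemLp f 2 P) :
    MemLp (fun x : Fin n → Ω => ∏ i, f (x i)) 2 (Measure.pi fun _ : Fin n => P) := by
  have h1 : AEStronglyMeasurable (fun x : Fin n → Ω => ∏ i, f (x i))
      (Measure.pi fun _ : Fin n => P) :=
    (Integrable.fintype_prod (f := fun _ : Fin n => f) fun i =>
      hf.integrable (by norm_num)).aestronglyMeasurable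
  refine (memLp_two_iff_integrable_sq h1).2 ?_
  simp only [← Finset.prod_pow]
  exact Integrable.fintype_prod (f := fun _ : Fin n => fun x => f x ^ 2) fun i => hf.integrable_sq

/-- Power functions of tests under product measures differ at most by a quantity controlled by
the Hellinger affinity `∫ √(dQ/dP) √(dR/dP) dP` of the factors. -/
theorem integral_test_sub_le (Q R : Measure Ω) [IsProbabilityMeasure Q] [IsProbabilityMeasure R]
    (hR : R ≪ P) {δ : (Fin n → Ω) → ℝ} (hδ : Measurable δ)
    (h01 : ∀ x, δ x ∈ Set.Icc (0 : ℝ) 1) :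
    ∫ x, δ x ∂(Measure.pi fun _ : Fin n => R) - ∫ x, δ x ∂(Measure.pi fun _ : Fin n => Q) ≤
      2 * √(2 - 2 * (∫ x, rootDensity P Q x * rootDensity P R x ∂P) ^ n) := by
  set c := ∫ x, rootDensity P Q x * rootDensity P R x ∂P
  set F : (Fin n → Ω) → ℝ := fun x => ∏ i, rootDensity P Q (x i) with hF
  set G : (Fin n → Ω) → ℝ := fun x => ∏ i, rootDensity P R (x i) with hG
  set π := Measure.pi fun _ : Fin n => P
  have hFm : MemLp F 2 π := memLp_prod (memLp_rootDensity P Q)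
  have hGm : MemLp G 2 π := memLp_prod (memLp_rootDensity P R)
  have hc0 : 0 ≤ c := integral_nonneg fun x =>
    mul_nonneg (rootDensity_nonneg _ _ _) (rootDensity_nonneg _ _ _)
  have hFF : ∫ x, F x * F x ∂π ≤ 1 := by
    rw [integral_prod_mul_prod]
    refine pow_le_one₀ (integral_nonneg fun x => mul_self_nonneg _) ?_
    simp only [← sq, integral_rootDensity_sq]
    linarith [measureReal_nonneg (μ := Q.singularPart P) (s := Set.univ)]
  have hGG : ∫ x, G x * G x ∂π ≤ 1 := by
    rw [integral_prod_mul_prod]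
    refine pow_le_one₀ (integral_nonneg fun x => mul_self_nonneg _) ?_
    simp only [← sq, integral_rootDensity_sq]
    linarith [measureReal_nonneg (μ := R.singularPart P) (s := Set.univ)]
  have hFG : ∫ x, F x * G x ∂π = c ^ n := integral_prod_mul_prod
  have iFF := hFm.integrable_mul hFm
  have iGG := hGm.integrable_mul hGm
  have iFG := hFm.integrable_mul hGm
  have hsub : ∫ x, (G x - F x) ^ 2 ∂π ≤ 2 - 2 * c ^ n := by
    have : ∀ x, (G x - F x) ^ 2 = G x * G x + F x * F x - 2 * (F x * G x) := fun x => by ring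
    simp only [this]
    rw [integral_sub (by exact iGG.add iFF) (by exact iFG.const_mul 2),
      integral_add (by exact iGG) (by exact iFF), integral_const_mul, hFG]
    linarith
  have hcn : c ^ n ≤ 1 := by
    have : 0 ≤ ∫ x, (G x - F x) ^ 2 ∂π := integral_nonneg fun x => sq_nonneg _
    linarith
  have hadd : ∫ x, (G x + F x) ^ 2 ∂π ≤ 2 ^ 2 := by
    have : ∀ x, (G x + F x) ^ 2 = G x * G x + F x * F x + 2 * (F x * G x) := fun x => by ring
    simp only [this]
    rw [integral_add (by exact iGG.add iFF) (by exact iFG.const_mul 2),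
      integral_add (by exact iGG) (by exact iFF), integral_const_mul, hFG]
    linarith
  have hRe : ∫ x, δ x ∂(Measure.pi fun _ : Fin n => R) = ∫ x, G x ^ 2 * δ x ∂π := by
    rw [← integral_test_mul_prod_eq, Measure.withDensity_rnDeriv_eq R P hR]
  have hQe := integral_test_mul_prod_le (P := P) Q hδ h01
  have bint : ∀ {f : (Fin n → Ω) → ℝ}, Integrable f π → Integrable (fun x => f x * δ x) π :=
    fun hf => hf.mul_bdd (c := 1) hδ.aestronglyMeasurable
      (Eventually.of_forall fun x => by
        rw [Real.norm_eq_abs, abs_le]; constructor <;> linarith [(h01 x).1, (h01 x).2])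
  -- Factor `G² - F² = (G - F)(G + F)` and apply Cauchy–Schwarz; the factor 2 is the bound on the
  -- `L₂` norm of `G + F`.
  calc _ ≤ ∫ x, G x ^ 2 * δ x ∂π - ∫ x, F x ^ 2 * δ x ∂π := by rw [hRe]; linarith
    _ = ∫ x, (G x ^ 2 * δ x - F x ^ 2 * δ x) ∂π :=
      (integral_sub (bint hGm.integrable_sq) (bint hFm.integrable_sq)).symm
    _ ≤ ∫ x, |(G x - F x) * (G x + F x)| ∂π := by
      refine integral_mono ((bint hGm.integrable_sq).sub (bint hFm.integrable_sq))
        ((hGm.sub hFm).integrable_mul (hGm.add hFm)).abs fun x => ?_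
      have : G x ^ 2 * δ x - F x ^ 2 * δ x = (G x - F x) * (G x + F x) * δ x := by ring
      simp only [this]
      refine (le_abs_self _).trans ?_
      rw [abs_mul]
      exact mul_le_of_le_one_right (abs_nonneg _)
        (abs_le.2 ⟨by linarith [(h01 x).1], (h01 x).2⟩)
    _ ≤ √(∫ x, (G x - F x) ^ 2 ∂π) * √(∫ x, (G x + F x) ^ 2 ∂π) :=
      abs_integral_mul_le (hGm.sub hFm) (hGm.add hFm)
    _ ≤ √(2 - 2 * c ^ n) * 2 := by
      gcongr
      exact Real.sqrt_le_iff.2 ⟨by norm_num, hadd⟩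
    _ = _ := mul_comm _ _

end Hellinger

/-! ### Local alternatives -/

theorem scale_pos {n : ℕ} (hn : 1 ≤ n) : 0 < scale n := by
  unfold scale; positivity

theorem scale_nonneg (n : ℕ) : 0 ≤ scale n := by
  unfold scale; positivity

theorem scale_sq (n : ℕ) : scale n ^ 2 = 1 / n := by
  simp [scale, Real.sq_sqrt]

theorem natCast_mul_scale_sq {n : ℕ} (hn : 1 ≤ n) : n * scale n ^ 2 = 1 := by
  rw [scale_sq]; field_simp

theorem tendsto_scale : Tendsto scale atTop (𝓝 0) := by
  unfold scale
  simp only [one_div]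
  exact tendsto_inv_atTop_zero.comp (Real.tendsto_sqrt_atTop.comp tendsto_natCast_atTop_atTop)

theorem IsLocalAlternative.tendsto_natCast_mul {P : Measure Ω} {g : Lp ℝ 2 P}
    {Q : ℕ → ProbabilityMeasure Ω} (hQ : IsLocalAlternative P g Q) :
    Tendsto (fun n : ℕ => n * rootDistSq P (Q n : Measure Ω) g (scale n)) atTop (𝓝 0) := by
  refine hQ.congr fun n => ?_
  rw [scale_sq]; simp [mul_comm]

section Local

variable {P : Measure Ω} [IsProbabilityMeasure P] {g : Lp ℝ 2 P} {Q R : ℕ → ProbabilityMeasure Ω}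

theorem memLp_rootDensity_sub (ν : Measure Ω) [IsFiniteMeasure ν] (g : Lp ℝ 2 P) (s : ℝ) :
    MemLp (fun x => rootDensity P ν x - (1 + s / 2 * g x)) 2 P := by
  have h1 : MemLp (fun x => s / 2 * g x) 2 P := (Lp.memLp g).const_mul (s / 2)
  have h2 : MemLp (fun x => 1 + s / 2 * g x) 2 P := (memLp_const (1 : ℝ)).add h1
  exact (memLp_rootDensity P ν).sub h2

/-- Both roots are compared with `1 + (s/2) g` through `(a - b)² ≤ 2 (a - c)² + 2 (b - c)²`. The
integrals of `a²` and `b²` fall short of 1 by the singular masses, which `rootDistSq` also contains.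
-/
theorem one_sub_affinity_le (μ ν : Measure Ω) [IsProbabilityMeasure μ] [IsProbabilityMeasure ν]
    (g : Lp ℝ 2 P) (s : ℝ) :
    1 - ∫ x, rootDensity P μ x * rootDensity P ν x ∂P ≤
      rootDistSq P μ g s + rootDistSq P ν g s := by
  set a := rootDensity P μ
  set b := rootDensity P ν
  have ha : MemLp a 2 P := memLp_rootDensity P μ
  have hb : MemLp b 2 P := memLp_rootDensity P ν
  have hA := (memLp_rootDensity_sub μ g s).integrable_sq
  have hB := (memLp_rootDensity_sub ν g s).integrable_sq
  have key : ∫ x, (a x ^ 2 + b x ^ 2 - 2 * (a x * b x)) ∂P ≤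
      ∫ x, (2 * (a x - (1 + s / 2 * g x)) ^ 2 + 2 * (b x - (1 + s / 2 * g x)) ^ 2) ∂P := by
    refine integral_mono
      ((ha.integrable_sq.add hb.integrable_sq).sub ((ha.integrable_mul hb).const_mul 2))
      ((hA.const_mul 2).add (hB.const_mul 2)) fun x => ?_
    change a x ^ 2 + b x ^ 2 - 2 * (a x * b x) ≤ 2 * (a x - (1 + s / 2 * g x)) ^ 2 +
      2 * (b x - (1 + s / 2 * g x)) ^ 2
    nlinarith [sq_nonneg (a x - (1 + s / 2 * g x) + (b x - (1 + s / 2 * g x)))]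
  rw [integral_sub (by exact ha.integrable_sq.add hb.integrable_sq)
      (by exact (ha.integrable_mul hb).const_mul 2),
    integral_add ha.integrable_sq hb.integrable_sq,
    integral_add (hA.const_mul 2) (hB.const_mul 2), integral_const_mul, integral_const_mul,
    integral_const_mul, integral_rootDensity_sq, integral_rootDensity_sq] at key
  have hμ : rootDistSq P μ g s = ∫ x, (a x - (1 + s / 2 * g x)) ^ 2 ∂P +
    (μ.singularPart P).real Set.univ := rfl
  have hν : rootDistSq P ν g s = ∫ x, (b x - (1 + s / 2 * g x)) ^ 2 ∂P +
    (ν.singularPart P).real Set.univ := rfl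
  have h1 := measureReal_nonneg (μ := μ.singularPart P) (s := Set.univ)
  have h2 := measureReal_nonneg (μ := ν.singularPart P) (s := Set.univ)
  linarith

/-- Two local alternatives with the same tangent are asymptotically indistinguishable. -/
theorem IsLocalAlternative.exists_abs_sub_le (hQ : IsLocalAlternative P g Q)
    (hR : IsLocalAlternative P g R) (hac : ∀ n, (R n : Measure Ω) ≪ P) :
    ∃ ε : ℕ → ℝ, Tendsto ε atTop (𝓝 0) ∧ ∀ δ, IsTest δ → ∀ n,
      |rejectionProb R δ n - rejectionProb Q δ n| ≤ ε n := by
  set c : ℕ → ℝ := fun n =>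
    ∫ x, rootDensity P (Q n : Measure Ω) x * rootDensity P (R n : Measure Ω) x ∂P with hc
  refine ⟨fun n => 2 * √(2 - 2 * c n ^ n), ?_, fun δ hδ n => ?_⟩
  · have hup : ∀ n, c n - 1 ≤ 0 := fun n => by
      set a := rootDensity P (Q n : Measure Ω)
      set b := rootDensity P (R n : Measure Ω)
      have ha : MemLp a 2 P := memLp_rootDensity P _
      have hb : MemLp b 2 P := memLp_rootDensity P _
      have h : c n ≤ ∫ x, (a x ^ 2 / 2 + b x ^ 2 / 2) ∂P := integral_mono
        (ha.integrable_mul hb) ((ha.integrable_sq.div_const 2).add (hb.integrable_sq.div_const 2))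
        fun x => by
          change a x * b x ≤ a x ^ 2 / 2 + b x ^ 2 / 2
          nlinarith [sq_nonneg (a x - b x)]
      rw [integral_add (ha.integrable_sq.div_const 2) (hb.integrable_sq.div_const 2),
        integral_div, integral_div, integral_rootDensity_sq, integral_rootDensity_sq] at h
      have h1 := measureReal_nonneg (μ := (Q n : Measure Ω).singularPart P) (s := Set.univ)
      have h2 := measureReal_nonneg (μ := (R n : Measure Ω).singularPart P) (s := Set.univ)
      linarith
    -- Both distances are `o(s_n²) = o(1/n)`, so the affinity is `1 - o(1/n)` and its `n`th power
    -- tends to `e⁰ = 1`.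
    have h0 : Tendsto (fun n : ℕ => n * (c n - 1)) atTop (𝓝 0) := by
      refine tendsto_of_tendsto_of_tendsto_of_le_of_le
        (g := fun n : ℕ => -(n * rootDistSq P (Q n : Measure Ω) g (scale n) +
          n * rootDistSq P (R n : Measure Ω) g (scale n))) (h := fun _ => 0)
        (by simpa using (hQ.tendsto_natCast_mul.add hR.tendsto_natCast_mul).neg)
        tendsto_const_nhds (fun n => ?_) fun n =>
          mul_nonpos_of_nonneg_of_nonpos n.cast_nonneg (hup n)
      have := one_sub_affinity_le (P := P) (Q n : Measure Ω) (R n : Measure Ω) g (scale n)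
      change -(n * rootDistSq P (Q n : Measure Ω) g (scale n) +
          n * rootDistSq P (R n : Measure Ω) g (scale n)) ≤ n * (c n - 1)
      rw [← mul_add, ← mul_neg]
      exact mul_le_mul_of_nonneg_left (by linarith) n.cast_nonneg
    have h1 := Real.tendsto_one_add_pow_exp_of_tendsto h0
    simp only [add_sub_cancel, Real.exp_zero] at h1
    have h2 : Tendsto (fun n => 2 * √(2 - 2 * c n ^ n)) atTop (𝓝 (2 * √(2 - 2 * 1))) :=
      ((h1.const_mul 2).const_sub 2).sqrt.const_mul 2
    simpa using h2
  · have h1 := integral_test_sub_le (Q n : Measure Ω) (R n : Measure Ω) (hac n) (hδ n).1 (hδ n).2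
    -- The estimate is one-sided; applied to the complementary test `1 - δ` it yields the other
    -- side.
    have h2 := integral_test_sub_le (Q n : Measure Ω) (R n : Measure Ω) (hac n)
      (δ := fun x => 1 - δ n x) ((hδ n).1.const_sub 1)
      fun x => ⟨by linarith [((hδ n).2 x).2], by linarith [((hδ n).2 x).1]⟩
    have hint : ∀ (S : Measure (Fin n → Ω)) [IsProbabilityMeasure S], Integrable (δ n) S :=
      fun S _ => Integrable.of_bound (hδ n).1.aestronglyMeasurable 1
        (Eventually.of_forall fun x => by rw [Real.norm_eq_abs, abs_le]; constructor <;>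
          linarith [((hδ n).2 x).1, ((hδ n).2 x).2])
    rw [integral_sub (integrable_const 1) (hint _), integral_sub (integrable_const 1) (hint _)]
      at h2
    simp only [integral_const, probReal_univ, smul_eq_mul, mul_one] at h2
    rw [abs_le]
    simp only [rejectionProb]
    constructor <;> linarith

end Local

/-! ### Asymptotic normality under local alternatives -/

theorem norm_exp_mul_I_sub_one_le_abs (y : ℝ) : ‖Complex.exp (y * Complex.I) - 1‖ ≤ |y| := by
  simpa [mul_comm] using Real.norm_exp_I_mul_ofReal_sub_one_le (x := y)

theorem norm_exp_mul_I_sub_one_le_two (y : ℝ) : ‖Complex.exp (y * Complex.I) - 1‖ ≤ 2 := by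
  refine (norm_sub_le _ _).trans ?_
  rw [Complex.norm_exp_ofReal_mul_I, norm_one]; norm_num

theorem norm_exp_mul_I_sub_one_sub_le (y : ℝ) :
    ‖Complex.exp (y * Complex.I) - 1 - y * Complex.I‖ ≤ 2 * y ^ 2 := by
  have hn : ‖(y * Complex.I : ℂ)‖ = |y| := by simp
  rcases le_total |y| 1 with h | h
  · have := Complex.norm_exp_sub_one_sub_id_le (x := y * Complex.I) (by rwa [hn])
    rw [hn, sq_abs] at this
    linarith [sq_nonneg y]
  · refine (norm_sub_le _ _).trans ?_
    rw [hn]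
    have := norm_exp_mul_I_sub_one_le_abs y
    nlinarith [sq_abs y]

/-- As `n s_n² = 1`, the quadratic Taylor term contributes exactly `-a_n² / 2`, and the cubic
remainder is at most `|a_n|³ s_n`. -/
theorem tendsto_mul_exp_sub_one_sub {a : ℕ → ℝ} {b : ℝ} (ha : Tendsto a atTop (𝓝 b)) :
    Tendsto (fun n : ℕ => (n : ℂ) * (Complex.exp ((scale n * a n : ℝ) * Complex.I) - 1 -
      (scale n * a n : ℝ) * Complex.I)) atTop (𝓝 (-(b ^ 2 / 2 : ℝ))) := by
  have hz : Tendsto (fun n => scale n * a n) atTop (𝓝 0) := by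
    simpa using tendsto_scale.mul ha
  have h1 : Tendsto (fun n => (-(a n ^ 2 / 2 : ℝ) : ℂ)) atTop (𝓝 (-(b ^ 2 / 2 : ℝ))) :=
    ((Complex.continuous_ofReal.tendsto _).comp ((ha.pow 2).div_const 2)).neg
  refine (tendsto_iff_of_dist ?_).1 h1
  have h2 : Tendsto (fun n => |a n| ^ 3 * scale n) atTop (𝓝 0) := by
    simpa using (ha.abs.pow 3).mul tendsto_scale
  refine squeeze_zero' (Eventually.of_forall fun _ => dist_nonneg) ?_ h2
  filter_upwards [eventually_ge_atTop 1,
    (hz.abs.eventually (eventually_le_nhds (by simp : |(0 : ℝ)| < 1)))] with n hn hsmall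
  set z : ℂ := (scale n * a n : ℝ) * Complex.I with hzdef
  have hzn : ‖z‖ = |scale n * a n| := by simp [hzdef]
  have hb := Complex.exp_bound (x := z) (by rwa [hzn]) (n := 3) (by norm_num)
  have hs : ∑ m ∈ Finset.range 3, z ^ m / (m.factorial : ℂ) = 1 + z + z ^ 2 / 2 := by
    simp [Finset.sum_range_succ, Nat.factorial]
  have hz2 : z ^ 2 = -((scale n ^ 2 * a n ^ 2 : ℝ) : ℂ) := by
    rw [hzdef, mul_pow, Complex.I_sq]; push_cast; ring
  have hns : (n : ℂ) * ((scale n ^ 2 : ℝ) : ℂ) = 1 := by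
    exact_mod_cast natCast_mul_scale_sq hn
  have e : -((a n ^ 2 / 2 : ℝ) : ℂ) - n * (Complex.exp z - 1 - z) =
      -(n * (Complex.exp z - (1 + z + z ^ 2 / 2))) := by
    have : (n : ℂ) * z ^ 2 = -((a n ^ 2 : ℝ) : ℂ) := by
      rw [hz2]; push_cast at hns ⊢
      linear_combination -((a n : ℂ) ^ 2) * hns
    push_cast at this ⊢
    linear_combination (-1 / 2) * this
  rw [dist_eq_norm, e, norm_neg, norm_mul, ← hs, Complex.norm_natCast]
  calc (n : ℝ) * _ ≤ n * (‖z‖ ^ 3 * 1) := by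
        gcongr
        refine hb.trans ?_
        gcongr
        norm_num [Nat.factorial]
    _ = (n * scale n ^ 2) * (|a n| ^ 3 * scale n) := by
        rw [hzn, abs_mul, abs_of_nonneg (scale_nonneg n)]; ring
    _ = _ := by rw [natCast_mul_scale_sq hn, one_mul]

theorem tendsto_inv_scale_mul_exp_sub_one {a : ℕ → ℝ} {b : ℝ} (ha : Tendsto a atTop (𝓝 b)) :
    Tendsto (fun n : ℕ => ((scale n)⁻¹ : ℂ) *
      (Complex.exp ((scale n * a n : ℝ) * Complex.I) - 1)) atTop (𝓝 (b * Complex.I)) := by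
  have h1 : Tendsto (fun n => (a n * Complex.I : ℂ)) atTop (𝓝 (b * Complex.I)) :=
    ((Complex.continuous_ofReal.tendsto _).comp ha).mul_const _
  refine (tendsto_iff_of_dist ?_).1 h1
  have h2 : Tendsto (fun n => 2 * (a n) ^ 2 * scale n) atTop (𝓝 0) := by
    simpa using ((ha.pow 2).const_mul 2).mul tendsto_scale
  refine squeeze_zero' (Eventually.of_forall fun _ => dist_nonneg) ?_ h2
  filter_upwards [eventually_ge_atTop 1] with n hn
  have hs := scale_pos hn
  have hs' : (scale n : ℂ) ≠ 0 := by exact_mod_cast hs.ne'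
  have e : (a n * Complex.I : ℂ) - ((scale n)⁻¹ : ℂ) *
      (Complex.exp ((scale n * a n : ℝ) * Complex.I) - 1) = -(((scale n)⁻¹ : ℂ) *
      (Complex.exp ((scale n * a n : ℝ) * Complex.I) - 1 - (scale n * a n : ℝ) * Complex.I)) := by
    push_cast; field_simp; ring
  rw [dist_eq_norm, e, norm_neg, norm_mul, norm_inv, Complex.norm_real, Real.norm_eq_abs,
    abs_of_pos hs]
  calc _ ≤ (scale n)⁻¹ * (2 * (scale n * a n) ^ 2) := by
        gcongr; exact norm_exp_mul_I_sub_one_sub_le _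
    _ = _ := by field_simp

section CharFun

variable {P : Measure Ω} [IsProbabilityMeasure P] {g : Lp ℝ 2 P} {Q : ℕ → ProbabilityMeasure Ω}
  {k : ℕ → Ω → ℝ} {K : Lp ℝ 2 P} {H : Ω → ℝ}

/-- With `e = exp(i s t k) - 1`, the integrand is `n e (1 + s g / 2)²`, expanded with `n s² = 1`,
minus the linear term `i n s t k`. That term is of order `√n` and has to be removed before passing
to the limit; it will integrate to zero when `k` is centred. The three summands tend to `-t²K²/2`,
`i t K g` and `0`, and are dominated by multiples of `H²`, `|H g|` and `g²`. -/
theorem tendsto_integral_main_term (hk : ∀ n, Measurable (k n)) (hH : MemLp H 2 P)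
    (hkH : ∀ n, ∀ᵐ x ∂P, |k n x| ≤ H x)
    (hlim : ∀ᵐ x ∂P, Tendsto (fun n => k n x) atTop (𝓝 (K x))) (g : Lp ℝ 2 P) (t : ℝ) :
    (∀ᶠ n : ℕ in atTop, Integrable (fun x => (n : ℂ) *
        (Complex.exp ((scale n * (t * k n x) : ℝ) * Complex.I) - 1 -
          (scale n * (t * k n x) : ℝ) * Complex.I) +
        ((scale n)⁻¹ : ℂ) * (Complex.exp ((scale n * (t * k n x) : ℝ) * Complex.I) - 1) * g x +
        (Complex.exp ((scale n * (t * k n x) : ℝ) * Complex.I) - 1) * (g x ^ 2 / 4 : ℝ)) P) ∧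
    Tendsto (fun n : ℕ => ∫ x, ((n : ℂ) *
        (Complex.exp ((scale n * (t * k n x) : ℝ) * Complex.I) - 1 -
          (scale n * (t * k n x) : ℝ) * Complex.I) +
        ((scale n)⁻¹ : ℂ) * (Complex.exp ((scale n * (t * k n x) : ℝ) * Complex.I) - 1) * g x +
        (Complex.exp ((scale n * (t * k n x) : ℝ) * Complex.I) - 1) * (g x ^ 2 / 4 : ℝ)) ∂P) atTop
      (𝓝 (t * inner ℝ K g * Complex.I - ‖K‖ ^ 2 * t ^ 2 / 2)) := by
  have hgm : Measurable g := (Lp.stronglyMeasurable g).measurable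
  have hbound : ∀ᶠ n : ℕ in atTop, ∀ᵐ x ∂P, ‖(n : ℂ) *
        (Complex.exp ((scale n * (t * k n x) : ℝ) * Complex.I) - 1 -
          (scale n * (t * k n x) : ℝ) * Complex.I) +
        ((scale n)⁻¹ : ℂ) * (Complex.exp ((scale n * (t * k n x) : ℝ) * Complex.I) - 1) * g x +
        (Complex.exp ((scale n * (t * k n x) : ℝ) * Complex.I) - 1) * (g x ^ 2 / 4 : ℝ)‖ ≤
      2 * t ^ 2 * H x ^ 2 + |t| * |H x * g x| + g x ^ 2 := by
    filter_upwards [eventually_ge_atTop 1] with n hn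
    filter_upwards [hkH n] with x hx
    have hs := scale_pos hn
    set y := scale n * (t * k n x)
    refine (norm_add₃_le).trans ?_
    rw [norm_mul, norm_mul, norm_mul, norm_mul, norm_inv, Complex.norm_real, Complex.norm_real,
      Complex.norm_real, Real.norm_eq_abs, Real.norm_eq_abs, Real.norm_eq_abs, abs_of_pos hs,
      Complex.norm_natCast, abs_of_nonneg (by positivity : 0 ≤ g x ^ 2 / 4)]
    have hH0 : 0 ≤ H x := (abs_nonneg _).trans hx
    gcongr ?_ + ?_ + ?_
    · calc _ ≤ (n : ℝ) * (2 * y ^ 2) := by gcongr; exact norm_exp_mul_I_sub_one_sub_le _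
        _ = (n * scale n ^ 2) * (2 * t ^ 2 * |k n x| ^ 2) := by rw [sq_abs]; ring
        _ ≤ _ := by rw [natCast_mul_scale_sq hn, one_mul]; gcongr
    · calc _ ≤ (scale n)⁻¹ * |y| * |g x| := by gcongr; exact norm_exp_mul_I_sub_one_le_abs _
        _ = |t| * (|k n x| * |g x|) := by
          simp only [y, abs_mul, abs_of_pos hs]; field_simp
        _ ≤ _ := by rw [abs_mul, abs_of_nonneg hH0]; gcongr
    · calc _ ≤ 2 * (g x ^ 2 / 4) := by gcongr; exact norm_exp_mul_I_sub_one_le_two _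
        _ ≤ _ := by nlinarith [sq_nonneg (g x)]
  have hmeas : ∀ n : ℕ, AEStronglyMeasurable (fun x => (n : ℂ) *
        (Complex.exp ((scale n * (t * k n x) : ℝ) * Complex.I) - 1 -
          (scale n * (t * k n x) : ℝ) * Complex.I) +
        ((scale n)⁻¹ : ℂ) * (Complex.exp ((scale n * (t * k n x) : ℝ) * Complex.I) - 1) * g x +
        (Complex.exp ((scale n * (t * k n x) : ℝ) * Complex.I) - 1) * (g x ^ 2 / 4 : ℝ)) P := by
    intro n
    have := hk n
    refine Measurable.aestronglyMeasurable ?_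
    fun_prop
  have hint : Integrable (fun x => 2 * t ^ 2 * H x ^ 2 + |t| * |H x * g x| + g x ^ 2) P :=
    ((hH.integrable_sq.const_mul _).add ((hH.integrable_mul (Lp.memLp g)).abs.const_mul _)).add
      (Lp.memLp g).integrable_sq
  refine ⟨?_, ?_⟩
  · filter_upwards [hbound] with n hn using hint.mono' (hmeas n) hn
  have hval : (t * inner ℝ K g * Complex.I - ‖K‖ ^ 2 * t ^ 2 / 2 : ℂ) =
      ∫ x, (-((t * K x) ^ 2 / 2 : ℝ) + (t * K x : ℝ) * Complex.I * g x : ℂ) ∂P := by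
    have i1 : Integrable (fun x => (t * K x) ^ 2 / 2) P :=
      ((Lp.memLp K).const_mul t).integrable_sq.div_const 2
    have i2 : Integrable (fun x => t * (K x * g x)) P :=
      ((Lp.memLp K).integrable_mul (Lp.memLp g)).const_mul t
    have e : ∀ x, (-((t * K x) ^ 2 / 2 : ℝ) + (t * K x : ℝ) * Complex.I * g x : ℂ) =
        ((-((t * K x) ^ 2 / 2) : ℝ) : ℂ) + ((t * (K x * g x) : ℝ) : ℂ) * Complex.I := fun x => by
      push_cast; ring
    simp only [e]
    rw [integral_add (by exact i1.neg.ofReal) (by exact i2.ofReal.mul_const _),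
      integral_mul_const, integral_complex_ofReal, integral_complex_ofReal, integral_neg, integral_div,
      integral_const_mul]
    have h1 : ∫ x, K x * g x ∂P = inner ℝ K g := by
      simp [L2.inner_def, mul_comm]
    have h2 : ∫ x, (t * K x) ^ 2 ∂P = t ^ 2 * ‖K‖ ^ 2 := by
      rw [← real_inner_self_eq_norm_sq, L2.inner_def, ← integral_const_mul]
      exact integral_congr_ae (Eventually.of_forall fun x => by simp [sq]; ring)
    rw [h1, h2]; push_cast; ring
  rw [hval]
  refine tendsto_integral_filter_of_dominated_convergence _ (Eventually.of_forall hmeas) hbound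
    hint ?_
  filter_upwards [hlim] with x hx
  have hx' : Tendsto (fun n => t * k n x) atTop (𝓝 (t * K x)) := hx.const_mul t
  have h3 : Tendsto (fun n : ℕ => Complex.exp ((scale n * (t * k n x) : ℝ) * Complex.I) - 1) atTop
      (𝓝 0) := by
    have h := tendsto_scale.mul hx'
    have hc : Continuous fun y : ℝ => Complex.exp (y * Complex.I) - 1 := by fun_prop
    simpa [Function.comp_def] using (hc.tendsto _).comp h
  have := ((tendsto_mul_exp_sub_one_sub hx').add
    ((tendsto_inv_scale_mul_exp_sub_one hx').mul_const (g x : ℂ))).add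
    (h3.mul_const ((g x ^ 2 / 4 : ℝ) : ℂ))
  simpa using this

/-- Write the root density as `1 + s (g/2 + w)`. The local alternative condition says that `∫ w² dP`
plus `n` times the singular mass tends to zero. What remains beyond the main term is at least linear
in `w`, so Cauchy–Schwarz makes it vanish. -/
theorem tendsto_natCast_mul_integral_exp_sub_one (hQ : IsLocalAlternative P g Q)
    (hk : ∀ n, Measurable (k n)) (hH : MemLp H 2 P) (hkH : ∀ n, ∀ᵐ x ∂P, |k n x| ≤ H x)
    (hlim : ∀ᵐ x ∂P, Tendsto (fun n => k n x) atTop (𝓝 (K x))) (hk0 : ∀ n, ∫ x, k n x ∂P = 0)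
    (t : ℝ) :
    Tendsto (fun n : ℕ => (n : ℂ) * ∫ x, (Complex.exp ((scale n * (t * k n x) : ℝ) * Complex.I) - 1)
      ∂(Q n : Measure Ω)) atTop (𝓝 (t * inner ℝ K g * Complex.I - ‖K‖ ^ 2 * t ^ 2 / 2)) := by
  obtain ⟨hMi, hM⟩ := tendsto_integral_main_term hk hH hkH hlim g t
  refine (tendsto_iff_of_dist ?_).1 hM
  set d : ℕ → ℝ := fun n => n * rootDistSq P (Q n : Measure Ω) g (scale n)
  have hd : Tendsto d atTop (𝓝 0) := hQ.tendsto_natCast_mul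
  -- `A` bounds the coefficient of `w` in the remainder: `2 s⁻¹ |e| ≤ 2 |t| H` and `|e g| ≤ 2 |g|`.
  set A : Ω → ℝ := fun x => 2 * |t| * H x + 2 * |g x|
  have hA : MemLp A 2 P := (hH.const_mul _).add ((Lp.memLp g).abs.const_mul _)
  have hlim0 : Tendsto (fun n => √(∫ x, A x ^ 2 ∂P) * √(d n) + 2 * d n) atTop (𝓝 0) := by
    simpa using (hd.sqrt.const_mul √(∫ x, A x ^ 2 ∂P)).add (hd.const_mul 2)
  refine squeeze_zero' (Eventually.of_forall fun _ => dist_nonneg) ?_ hlim0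
  filter_upwards [eventually_ge_atTop 1, hMi] with n hn hMn
  have hs := scale_pos hn
  have hns := natCast_mul_scale_sq hn
  set s := scale n
  set φ := rootDensity P (Q n : Measure Ω)
  set e : Ω → ℂ := fun x => Complex.exp ((s * (t * k n x) : ℝ) * Complex.I) - 1
  have hem : Measurable e := by
    have := hk n
    fun_prop
  set M : Ω → ℂ := fun x => (n : ℂ) * (e x - (s * (t * k n x) : ℝ) * Complex.I) +
    (s⁻¹ : ℂ) * e x * g x + e x * (g x ^ 2 / 4 : ℝ)
  set w : Ω → ℝ := fun x => s⁻¹ * (φ x - (1 + s / 2 * g x)) with hw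
  have hwL : MemLp w 2 P := (memLp_rootDensity_sub (Q n : Measure Ω) g s).const_mul _
  have hφ : ∀ x, φ x = 1 + s * (g x / 2 + w x) := fun x => by
    simp only [hw]; field_simp; ring
  have hkint : Integrable (fun x => k n x) P :=
    (hH.integrable (by norm_num)).mono' (hk n).aestronglyMeasurable (hkH n)
  have heQ : ∀ (ν : Measure Ω) [IsFiniteMeasure ν], Integrable e ν := fun ν _ =>
    Integrable.of_bound hem.aestronglyMeasurable 2
      (Eventually.of_forall fun x => norm_exp_mul_I_sub_one_le_two _)
  have hφe : Integrable (fun x => φ x ^ 2 • e x) P :=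
    (integrable_rootDensity_sq P (Q n : Measure Ω)).smul_bdd 2 hem.aestronglyMeasurable
      (Eventually.of_forall fun x => norm_exp_mul_I_sub_one_le_two _)
  have hsplit : ∫ x, e x ∂(Q n : Measure Ω) = ∫ x, φ x ^ 2 • e x ∂P +
      ∫ x, e x ∂((Q n : Measure Ω).singularPart P) := by
    conv_lhs => rw [Measure.haveLebesgueDecomposition_add (Q n : Measure Ω) P]
    rw [integral_add_measure (heQ _) (heQ _), ← withDensity_rootDensity,
      integral_withDensity_ofReal ((measurable_rootDensity _ _).pow_const 2)
        (fun x => sq_nonneg _), add_comm]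
  -- The last term cancels the linear term inside `M` pointwise and has integral zero because `k n`
  -- is centred.
  set R : Ω → ℂ := fun x => (n : ℂ) * (φ x ^ 2 • e x) - M x -
    ((n * s * t : ℝ) : ℂ) * Complex.I * (k n x : ℂ)
  have hRint : ∫ x, R x ∂P = n * ∫ x, φ x ^ 2 • e x ∂P - ∫ x, M x ∂P := by
    rw [integral_sub (by exact (hφe.const_mul _).sub hMn) (by exact hkint.ofReal.const_mul _),
      integral_sub (by exact hφe.const_mul _) (by exact hMn), integral_const_mul,
      integral_const_mul, integral_complex_ofReal, hk0]
    simp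
  have hRle : ∀ᵐ x ∂P, ‖R x‖ ≤ |A x * w x| + 2 * w x ^ 2 := by
    filter_upwards [hkH n] with x hx
    have hH0 : 0 ≤ H x := (abs_nonneg _).trans hx
    have hnsC : (n : ℂ) * (s : ℂ) ^ 2 = 1 := by exact_mod_cast hns
    have hsC : (s : ℂ) ≠ 0 := by exact_mod_cast hs.ne'
    have hnC : (n : ℂ) * (s : ℂ) = (s : ℂ)⁻¹ := by
      field_simp; exact hnsC
    have hR : R x = e x * ((2 * s⁻¹ * w x : ℝ) : ℂ) + e x * ((g x * w x + w x ^ 2 : ℝ) : ℂ) := by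
      simp only [R, M, hφ, Complex.real_smul]
      push_cast
      linear_combination (e x * (g x + 2 * w x)) * hnC +
        (e x * (g x / 2 + w x) ^ 2) * hnsC
    rw [hR]
    refine (norm_add_le _ _).trans ?_
    rw [norm_mul, norm_mul, Complex.norm_real, Complex.norm_real, Real.norm_eq_abs,
      Real.norm_eq_abs]
    have h1 : ‖e x‖ * |2 * s⁻¹ * w x| ≤ 2 * |t| * H x * |w x| := by
      calc _ ≤ |s * (t * k n x)| * |2 * s⁻¹ * w x| := by
            gcongr; exact norm_exp_mul_I_sub_one_le_abs _
        _ = 2 * |t| * |k n x| * |w x| := by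
            simp only [abs_mul, abs_inv, abs_of_pos hs, abs_two]; field_simp
        _ ≤ _ := by gcongr
    have h2 : ‖e x‖ * |g x * w x + w x ^ 2| ≤ 2 * |g x| * |w x| + 2 * w x ^ 2 := by
      calc _ ≤ 2 * (|g x * w x| + |w x ^ 2|) := by
            gcongr
            · exact norm_exp_mul_I_sub_one_le_two _
            · exact abs_add_le _ _
        _ = _ := by rw [abs_mul, abs_of_nonneg (sq_nonneg (w x))]; ring
    have h3 : |A x * w x| = 2 * |t| * H x * |w x| + 2 * |g x| * |w x| := by
      rw [abs_mul, abs_of_nonneg (by positivity : 0 ≤ A x)]; ring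
    linarith
  have hww : ∫ x, w x ^ 2 ∂P = n * ∫ x, (φ x - (1 + s / 2 * g x)) ^ 2 ∂P := by
    rw [← integral_const_mul]
    refine integral_congr_ae (Eventually.of_forall fun x => ?_)
    simp only [hw, mul_pow]
    rw [inv_pow, ← eq_inv_of_mul_eq_one_left hns]
  set σ := ((Q n : Measure Ω).singularPart P).real Set.univ with hσ
  have hσ0 : 0 ≤ σ := measureReal_nonneg
  have hdn : d n = ∫ x, w x ^ 2 ∂P + n * σ := by
    rw [hww, ← mul_add]; rfl
  have hw0 : 0 ≤ ∫ x, w x ^ 2 ∂P := integral_nonneg fun x => sq_nonneg _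
  have hsing : ‖∫ x, e x ∂((Q n : Measure Ω).singularPart P)‖ ≤ 2 * σ :=
    norm_integral_le_of_norm_le_const (Eventually.of_forall fun x =>
      norm_exp_mul_I_sub_one_le_two _)
  have hRn : ‖∫ x, R x ∂P‖ ≤ √(∫ x, A x ^ 2 ∂P) * √(∫ x, w x ^ 2 ∂P) + 2 * ∫ x, w x ^ 2 ∂P := by
    have hAw : Integrable (fun x => |A x * w x|) P := (hA.integrable_mul hwL).abs
    have hw2 : Integrable (fun x => 2 * w x ^ 2) P := hwL.integrable_sq.const_mul 2
    refine (norm_integral_le_of_norm_le (hAw.add hw2) hRle).trans ?_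
    simp only [Pi.add_apply]
    rw [integral_add hAw hw2, integral_const_mul]
    gcongr
    exact abs_integral_mul_le hA hwL
  rw [dist_comm, dist_eq_norm]
  have e1 : (n : ℂ) * ∫ x, e x ∂(Q n : Measure Ω) - ∫ x, M x ∂P =
      ∫ x, R x ∂P + n * ∫ x, e x ∂((Q n : Measure Ω).singularPart P) := by
    rw [hRint, hsplit]; ring
  calc ‖(n : ℂ) * ∫ x, e x ∂(Q n : Measure Ω) - ∫ x, M x ∂P‖
      ≤ ‖∫ x, R x ∂P‖ + n * (2 * σ) := by
        rw [e1]
        refine (norm_add_le _ _).trans ?_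
        rw [norm_mul, Complex.norm_natCast]
        gcongr
    _ ≤ √(∫ x, A x ^ 2 ∂P) * √(∫ x, w x ^ 2 ∂P) + 2 * ∫ x, w x ^ 2 ∂P + n * (2 * σ) := by
        gcongr
    _ ≤ √(∫ x, A x ^ 2 ∂P) * √(d n) + 2 * d n := by
        have : √(∫ x, w x ^ 2 ∂P) ≤ √(d n) := Real.sqrt_le_sqrt (by
          rw [hdn]; exact le_add_of_nonneg_right (by positivity))
        have h2 := mul_le_mul_of_nonneg_left this (Real.sqrt_nonneg (∫ x, A x ^ 2 ∂P))
        rw [hdn] at h2 ⊢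
        linarith

theorem charFun_map_scale_mul_sum (Q : Measure Ω) [IsProbabilityMeasure Q] {k : Ω → ℝ}
    (hk : Measurable k) (n : ℕ) (t : ℝ) :
    charFun ((Measure.pi fun _ : Fin n => Q).map fun x => scale n * ∑ i, k (x i)) t =
      (1 + ∫ x, (Complex.exp ((scale n * (t * k x) : ℝ) * Complex.I) - 1) ∂Q) ^ n := by
  have hT : Measurable fun x : Fin n → Ω => scale n * ∑ i, k (x i) := by fun_prop
  have hint : Integrable (fun x => Complex.exp ((scale n * (t * k x) : ℝ) * Complex.I)) Q :=
    Integrable.of_bound (by fun_prop) 1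
      (Eventually.of_forall fun x => (Complex.norm_exp_ofReal_mul_I _).le)
  rw [charFun_apply_real, integral_map hT.aemeasurable (by fun_prop),
    integral_sub hint (integrable_const _)]
  simp only [integral_const, probReal_univ, one_smul, add_sub_cancel]
  have := integral_fintype_prod_eq_pow (ι := Fin n) (μ := Q)
    (fun x => Complex.exp ((scale n * (t * k x) : ℝ) * Complex.I))
  rw [Fintype.card_fin] at this
  rw [← this]
  refine integral_congr_ae (Eventually.of_forall fun x => ?_)
  simp only [← Complex.exp_sum]
  congr 1
  push_cast
  rw [Finset.mul_sum, Finset.mul_sum, Finset.sum_mul]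
  exact Finset.sum_congr rfl fun i _ => by ring

theorem gaussianReal_real_Ioi (m : ℝ) {σ : ℝ} (hσ : 0 < σ) (τ : ℝ) :
    (gaussianReal m (σ ^ 2).toNNReal).real (Set.Ioi τ) = Phi ((m - τ) / σ) := by
  -- The reflecting map `z ↦ m - σ z` turns the upper tail into a lower one, as needed for `Phi`.
  have h1 : (gaussianReal 0 1).map (fun z => m + (-σ) * z) =
      gaussianReal m (σ ^ 2).toNNReal := by
    have : (fun z : ℝ => m + (-σ) * z) = (fun z => m + z) ∘ fun z => (-σ) * z := rfl
    rw [this, ← Measure.map_map (by fun_prop) (by fun_prop), gaussianReal_map_const_mul,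
      gaussianReal_map_const_add]
    congr 1
    · simp
    · ext; simp [sq_nonneg]
  have hna : NullSingletonClass (gaussianReal 0 1) := nullSingletonClass_gaussianReal one_ne_zero
  rw [← h1, Measure.real, Measure.map_apply (by fun_prop) measurableSet_Ioi, Phi, cdf_eq_real,
    Measure.real]
  congr 1
  have : (fun z => m + (-σ) * z) ⁻¹' Set.Ioi τ = Set.Iio ((m - τ) / σ) := by
    ext z
    simp only [Set.mem_preimage, Set.mem_Ioi, Set.mem_Iio, lt_div_iff₀ hσ]
    constructor <;> intro h <;> linarith
  rw [this]
  exact measure_congr Iio_ae_eq_Iic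

/-- The one-sided test with statistic `s_n ∑ k_n(x_i)` and critical value `τ`. -/
noncomputable def sumTest (k : ℕ → Ω → ℝ) (τ : ℝ) (n : ℕ) (x : Fin n → Ω) : ℝ :=
  if scale n * ∑ i, k n (x i) > τ then 1 else 0

theorem isTest_sumTest (hk : ∀ n, Measurable (k n)) (τ : ℝ) : IsTest (sumTest k τ) := by
  intro n
  refine ⟨?_, fun x => ?_⟩
  · have hT : Measurable fun x : Fin n → Ω => scale n * ∑ i, k n (x i) := by
      have := hk n
      fun_prop
    exact Measurable.ite (measurableSet_lt measurable_const hT) measurable_const measurable_const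
  · unfold sumTest
    split_ifs <;> simp

/-- The limiting power of a sum test under local alternatives with tangent `g`. -/
theorem tendsto_rejectionProb_sumTest (hQ : IsLocalAlternative P g Q)
    (hk : ∀ n, Measurable (k n)) (hH : MemLp H 2 P) (hkH : ∀ n, ∀ᵐ x ∂P, |k n x| ≤ H x)
    (hlim : ∀ᵐ x ∂P, Tendsto (fun n => k n x) atTop (𝓝 (K x))) (hk0 : ∀ n, ∫ x, k n x ∂P = 0)
    (hK : K ≠ 0) (τ : ℝ) :
    Tendsto (rejectionProb Q (sumTest k τ)) atTop (𝓝 (Phi ((inner ℝ K g - τ) / ‖K‖))) := by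
  have hT : ∀ n, Measurable fun x : Fin n → Ω => scale n * ∑ i, k n (x i) := fun n => by
    have := hk n
    fun_prop
  let μ : ℕ → ProbabilityMeasure ℝ := fun n =>
    ⟨(Measure.pi fun _ : Fin n => (Q n : Measure Ω)).map fun x => scale n * ∑ i, k n (x i),
      Measure.isProbabilityMeasure_map (hT n).aemeasurable⟩
  let μ₀ : ProbabilityMeasure ℝ :=
    ⟨gaussianReal (inner ℝ K g) (‖K‖ ^ 2).toNNReal, inferInstance⟩
  have hK0 : 0 < ‖K‖ := norm_pos_iff.2 hK
  -- Lévy's continuity theorem: the characteristic function is `(1 + z_n)^n` with `n z_n`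
  -- convergent. The portmanteau theorem then applies to the half-line, whose boundary point has no
  -- Gaussian mass.
  have hμ : Tendsto μ atTop (𝓝 μ₀) := by
    refine ProbabilityMeasure.tendsto_iff_tendsto_charFun.2 fun t => ?_
    simp only [μ, μ₀, ProbabilityMeasure.coe_mk, charFun_map_scale_mul_sum _ (hk _),
      charFun_gaussianReal, Real.coe_toNNReal _ (sq_nonneg ‖K‖)]
    rw [Complex.ofReal_pow]
    exact Complex.tendsto_one_add_pow_exp_of_tendsto
      (tendsto_natCast_mul_integral_exp_sub_one hQ hk hH hkH hlim hk0 t)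
  have hv : (‖K‖ ^ 2).toNNReal ≠ 0 := by simp [hK]
  have hna : NullSingletonClass (gaussianReal (inner ℝ K g) (‖K‖ ^ 2).toNNReal) :=
    nullSingletonClass_gaussianReal hv
  have hfr : μ₀ (frontier (Set.Ioi τ)) = 0 := by
    rw [frontier_Ioi]
    simp [μ₀]
  have key := ProbabilityMeasure.tendsto_measure_of_null_frontier_of_tendsto hμ hfr
  have key' := (NNReal.continuous_coe.tendsto _).comp key
  rw [← gaussianReal_real_Ioi _ hK0]
  refine (key'.congr fun n => ?_)
  have hms : MeasurableSet {x : Fin n → Ω | scale n * ∑ i, k n (x i) > τ} :=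
    measurableSet_lt measurable_const (hT n)
  have e : sumTest k τ n = Set.indicator {x : Fin n → Ω | scale n * ∑ i, k n (x i) > τ} 1 := by
    ext x; simp [sumTest, Set.indicator]
  rw [rejectionProb, e, integral_indicator_one hms]
  change ((Measure.pi fun _ : Fin n => (Q n : Measure Ω)).map _).real (Set.Ioi τ) = _
  rw [Measure.real, Measure.map_apply (hT n) measurableSet_Ioi]
  rfl

end CharFun

/-! ### Exponential families with truncated tangents -/

theorem tendsto_inv_scale_mul_real_exp_sub_one {a : ℕ → ℝ} {b : ℝ}
    (ha : Tendsto a atTop (𝓝 b)) :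
    Tendsto (fun n : ℕ => (scale n)⁻¹ * (Real.exp (scale n * a n) - 1)) atTop (𝓝 b) := by
  refine (tendsto_iff_of_dist ?_).1 ha
  have hz : Tendsto (fun n => scale n * a n) atTop (𝓝 0) := by
    simpa using tendsto_scale.mul ha
  have h2 : Tendsto (fun n => (a n) ^ 2 * scale n) atTop (𝓝 0) := by
    simpa using (ha.pow 2).mul tendsto_scale
  refine squeeze_zero' (Eventually.of_forall fun _ => dist_nonneg) ?_ h2
  filter_upwards [eventually_ge_atTop 1,
    (hz.abs.eventually (eventually_le_nhds (by simp : |(0 : ℝ)| < 1)))] with n hn hsmall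
  have hs := scale_pos hn
  have e : a n - (scale n)⁻¹ * (Real.exp (scale n * a n) - 1) =
      -((scale n)⁻¹ * (Real.exp (scale n * a n) - 1 - scale n * a n)) := by
    field_simp; ring
  rw [Real.dist_eq, e, abs_neg, abs_mul, abs_inv, abs_of_pos hs]
  calc _ ≤ (scale n)⁻¹ * (scale n * a n) ^ 2 := by
        gcongr; exact Real.abs_exp_sub_one_sub_id_le hsmall
    _ = _ := by field_simp

/-- The tangent `g` truncated at `√n`. -/
noncomputable def trunc (g : Ω → ℝ) (n : ℕ) : Ω → ℝ := truncation g (√(n : ℝ))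

theorem measurable_trunc {g : Ω → ℝ} (hg : Measurable g) (n : ℕ) : Measurable (trunc g n) :=
  (measurable_id.indicator measurableSet_Ioc).comp hg

theorem abs_trunc_le (g : Ω → ℝ) (n : ℕ) (x : Ω) : |trunc g n x| ≤ |g x| :=
  abs_truncation_le_abs_self g _ x

/-- This is the reason for truncating at `√n = 1 / s_n`: exponents stay in `[-1, 1]`, where `exp` is
integrable and has linear bounds, while the level still tends to infinity. -/
theorem abs_scale_mul_trunc_le_one (g : Ω → ℝ) (n : ℕ) (x : Ω) :
    |scale n * trunc g n x| ≤ 1 := by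
  have h := abs_truncation_le_bound g (√(n : ℝ)) x
  rw [abs_of_nonneg (Real.sqrt_nonneg _)] at h
  rw [abs_mul, abs_of_nonneg (scale_nonneg n)]
  calc scale n * |trunc g n x| ≤ 1 / √(n : ℝ) * √(n : ℝ) := by unfold scale; gcongr; exact h
    _ ≤ 1 := by rw [one_div]; exact inv_mul_le_one

theorem tendsto_trunc (g : Ω → ℝ) (x : Ω) :
    Tendsto (fun n => trunc g n x) atTop (𝓝 (g x)) := by
  refine tendsto_const_nhds.congr' ?_
  filter_upwards [(Real.tendsto_sqrt_atTop.comp tendsto_natCast_atTop_atTop).eventually_gt_atTop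
    |g x|] with n hn
  exact (truncation_eq_self hn).symm

section Tilt

variable (P : Measure Ω) [IsProbabilityMeasure P]

theorem integrable_exp_scale_mul_trunc {g : Ω → ℝ} (hg : Measurable g) (n : ℕ) :
    Integrable (fun x => Real.exp (scale n * trunc g n x)) P := by
  have := measurable_trunc hg n
  refine Integrable.of_bound (by fun_prop) (Real.exp 1) (Eventually.of_forall fun x => ?_)
  rw [Real.norm_eq_abs, Real.abs_exp]
  exact Real.exp_le_exp.2 ((le_abs_self _).trans (abs_scale_mul_trunc_le_one g n x))

theorem measurable_Lp {P : Measure Ω} (g : Lp ℝ 2 P) : Measurable g :=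
  (Lp.stronglyMeasurable g).measurable

/-- The law with density proportional to `exp (s_n g)`, `g` truncated, with respect to `P`. -/
noncomputable def tilt (g : Lp ℝ 2 P) (n : ℕ) : ProbabilityMeasure Ω :=
  ⟨P.tilted fun x => scale n * trunc g n x,
    isProbabilityMeasure_tilted (integrable_exp_scale_mul_trunc P (measurable_Lp g) n)⟩

theorem coe_tilt (g : Lp ℝ 2 P) (n : ℕ) :
    (tilt P g n : Measure Ω) = P.tilted fun x => scale n * trunc g n x := rfl

theorem tilt_absolutelyContinuous (g : Lp ℝ 2 P) (n : ℕ) : (tilt P g n : Measure Ω) ≪ P :=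
  tilted_absolutelyContinuous _ _

variable {P}

theorem abs_exp_scale_mul_trunc_le {g : Ω → ℝ} {c : ℝ} (hc : |c| ≤ 1) {n : ℕ} (hn : 1 ≤ n)
    (x : Ω) : |(scale n)⁻¹ * (Real.exp (scale n * (c * trunc g n x)) - 1)| ≤ 2 * |c| * |g x| := by
  have hs := scale_pos hn
  have h1 := abs_scale_mul_trunc_le_one g n x
  have h2 : |scale n * (c * trunc g n x)| ≤ 1 := by
    rw [mul_left_comm, abs_mul]; exact mul_le_one₀ hc (abs_nonneg _) h1
  rw [abs_mul, abs_inv, abs_of_pos hs]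
  calc _ ≤ (scale n)⁻¹ * (2 * |scale n * (c * trunc g n x)|) := by
        gcongr; exact Real.abs_exp_sub_one_le h2
    _ = 2 * |c| * |trunc g n x| := by
        rw [abs_mul, abs_mul, abs_of_pos hs]; field_simp
    _ ≤ _ := mul_le_mul_of_nonneg_left (abs_trunc_le g n x) (by positivity)

/-- The first-order term of the normalizing constant is `s_n ∫ g dP = 0`, so normalization is
invisible at the order `s_n`. -/
theorem tendsto_inv_scale_mul_normalizer {g : Lp ℝ 2 P} (hg : g ∈ tangents P) :
    Tendsto (fun n => (scale n)⁻¹ * (∫ x, Real.exp (scale n * trunc g n x) ∂P - 1)) atTop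
      (𝓝 0) := by
  have hgm := measurable_Lp g
  have h : Tendsto (fun n => ∫ x, (scale n)⁻¹ * (Real.exp (scale n * trunc g n x) - 1) ∂P) atTop
      (𝓝 (∫ x, g x ∂P)) := by
    refine tendsto_integral_filter_of_dominated_convergence (fun x => 2 * |g x|)
      (Eventually.of_forall fun n => ?_) ?_ ?_ ?_
    · have := measurable_trunc hgm n
      exact Measurable.aestronglyMeasurable (by fun_prop)
    · filter_upwards [eventually_ge_atTop 1] with n hn
      refine Eventually.of_forall fun x => ?_
      simpa using abs_exp_scale_mul_trunc_le (g := g) (c := 1) (by simp) hn x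
    · exact ((Lp.memLp g).integrable (by norm_num)).abs.const_mul 2
    · exact Eventually.of_forall fun x =>
        tendsto_inv_scale_mul_real_exp_sub_one (tendsto_trunc g x)
  rw [show ∫ x, g x ∂P = 0 from hg] at h
  refine h.congr fun n => ?_
  rw [integral_const_mul, integral_sub (integrable_exp_scale_mul_trunc P hgm n)
    (integrable_const 1)]
  simp

/-- The root density is `exp(s_n g / 2) / √Z_n`, with `g` truncated and `Z_n = 1 + o(s_n)`. Its
error divided by `s_n` tends to zero pointwise under a square-integrable bound, and there is no
singular part. -/
theorem isLocalAlternative_tilt {g : Lp ℝ 2 P} (hg : g ∈ tangents P) :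
    IsLocalAlternative P g (tilt P g) := by
  have hgm := measurable_Lp g
  set Z : ℕ → ℝ := fun n => ∫ x, Real.exp (scale n * trunc g n x) ∂P with hZ
  have hZpos : ∀ n, 0 < Z n := fun n =>
    integral_exp_pos (integrable_exp_scale_mul_trunc P hgm n)
  have hZ0 : Tendsto (fun n => (scale n)⁻¹ * (Z n - 1)) atTop (𝓝 0) :=
    tendsto_inv_scale_mul_normalizer hg
  have hZ1 : Tendsto Z atTop (𝓝 1) := by
    have h := (tendsto_scale.mul hZ0).add_const 1
    rw [mul_zero, zero_add] at h
    refine h.congr' ?_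
    filter_upwards [eventually_ge_atTop 1] with n hn
    have := scale_pos hn
    field_simp; ring
  set r : ℕ → ℝ := fun n => (√(Z n))⁻¹ with hr
  have hr1 : Tendsto r atTop (𝓝 1) := by
    simpa using hZ1.sqrt.inv₀ (by simp)
  have hr0 : Tendsto (fun n => (scale n)⁻¹ * (r n - 1)) atTop (𝓝 0) := by
    have h : Tendsto (fun n => -((scale n)⁻¹ * (Z n - 1)) * (r n / (1 + √(Z n)))) atTop
        (𝓝 (-0 * (1 / (1 + √1)))) :=
      hZ0.neg.mul (hr1.div (hZ1.sqrt.const_add 1) (by positivity))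
    simp only [neg_zero, zero_mul] at h
    refine h.congr fun n => ?_
    have h1 : 0 < √(Z n) := Real.sqrt_pos.2 (hZpos n)
    have h2 : Z n = √(Z n) ^ 2 := (Real.sq_sqrt (hZpos n).le).symm
    simp only [hr]
    have h3 : (√(Z n))⁻¹ - 1 = -(Z n - 1) * ((√(Z n))⁻¹ / (1 + √(Z n))) := by
      rw [h2]
      simp only [Real.sqrt_sq h1.le]
      field_simp; ring
    rw [h3]; ring
  have hroot : ∀ n, ∀ᵐ x ∂P, rootDensity P (tilt P g n : Measure Ω) x =
      Real.exp (scale n * (1 / 2 * trunc g n x)) * r n := fun n => by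
    have hm : AEMeasurable (fun x => scale n * trunc g n x) P :=
      ((measurable_trunc hgm n).const_mul _).aemeasurable
    filter_upwards [rnDeriv_tilted_left_self hm] with x hx
    rw [rootDensity, coe_tilt, hx, ENNReal.toReal_ofReal (div_nonneg (Real.exp_pos _).le
      (hZpos n).le), Real.sqrt_div (Real.exp_pos _).le, ← Real.exp_half]
    simp only [hr, div_eq_mul_inv]
    ring_nf
  have key : Tendsto (fun n => ∫ x, ((scale n)⁻¹ *
      (Real.exp (scale n * (1 / 2 * trunc g n x)) - 1) * r n + (scale n)⁻¹ * (r n - 1) -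
      1 / 2 * g x) ^ 2 ∂P) atTop (𝓝 (∫ _, (0 : ℝ) ∂P)) := by
    -- The exponential term contributes `2 |g|` (as `|r n| ≤ 2`), the normalization 1, and the
    -- tangent `|g| / 2`.
    refine tendsto_integral_filter_of_dominated_convergence (fun x => (3 * |g x| + 1) ^ 2)
      (Eventually.of_forall fun n => ?_) ?_ ?_ ?_
    · have := measurable_trunc hgm n
      exact Measurable.aestronglyMeasurable (by fun_prop)
    · have h1 := hr0.abs.eventually (eventually_le_nhds (by simp : |(0 : ℝ)| < 1))
      have h2 := hr1.abs.eventually (eventually_le_nhds (by simp : |(1 : ℝ)| < 2))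
      filter_upwards [eventually_ge_atTop 1, h1, h2] with n hn hn1 hn2
      refine Eventually.of_forall fun x => ?_
      rw [Real.norm_eq_abs, abs_pow]
      gcongr
      have h3 := abs_exp_scale_mul_trunc_le (g := g) (c := 1 / 2)
        (by rw [abs_of_pos] <;> norm_num) hn x
      rw [abs_of_pos (by norm_num : (0 : ℝ) < 1 / 2)] at h3
      refine (abs_sub _ _).trans ((add_le_add_left (abs_add_le _ _) _).trans ?_)
      have h4 : |(scale n)⁻¹ * (Real.exp (scale n * (1 / 2 * trunc g n x)) - 1) * r n| ≤
          |g x| * 2 := by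
        rw [abs_mul]
        exact mul_le_mul (by linarith) hn2 (abs_nonneg _) (abs_nonneg _)
      rw [abs_mul (1 / 2) (g x), abs_of_pos (by norm_num : (0 : ℝ) < 1 / 2)]
      linarith [abs_nonneg (g x)]
    · exact (((Lp.memLp g).abs.const_mul 3).add (memLp_const 1)).integrable_sq
    · refine Eventually.of_forall fun x => ?_
      have h1 := tendsto_inv_scale_mul_real_exp_sub_one ((tendsto_trunc g x).const_mul (1 / 2))
      simpa using (((h1.mul hr1).add hr0).sub_const (1 / 2 * g x)).pow 2
  rw [integral_zero] at key
  refine key.congr' ?_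
  filter_upwards [eventually_ge_atTop 1] with n hn
  have hs := scale_pos hn
  have hsing : (tilt P g n : Measure Ω).singularPart P = 0 :=
    Measure.singularPart_eq_zero_of_ac (tilt_absolutelyContinuous P g n)
  rw [rootDistSq, hsing, measureReal_zero_apply, add_zero, ← integral_div]
  refine integral_congr_ae ?_
  filter_upwards [hroot n] with x hx
  rw [rootDensity] at hx
  rw [hx]
  field_simp
  ring

/-! ### Neyman–Pearson optimality in the tilted model -/

theorem pi_tilted {n : ℕ} (μ : Measure Ω) [IsProbabilityMeasure μ] {T : Ω → ℝ}
    (hT : Integrable (fun x => Real.exp (T x)) μ) :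
    Measure.pi (fun _ : Fin n => μ.tilted T) =
      (Measure.pi fun _ : Fin n => μ).tilted fun x => ∑ i, T (x i) := by
  have hZ := integral_fintype_prod_eq_pow (ι := Fin n) (μ := μ) fun x => Real.exp (T x)
  rw [Fintype.card_fin] at hZ
  have h0 : 0 ≤ ∫ x, Real.exp (T x) ∂μ := integral_nonneg fun x => (Real.exp_pos _).le
  simp only [Measure.tilted]
  rw [pi_withDensity_ofReal (hT.div_const _) fun x => div_nonneg (Real.exp_pos _).le h0]
  simp only [Real.exp_sum, hZ, Finset.prod_div_distrib, Finset.prod_const, Finset.card_univ,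
    Fintype.card_fin]

/-- The Neyman–Pearson lemma for an exponential tilt. -/
theorem integral_tilted_le_of_integral_le {X : Type*} [MeasurableSpace X] (μ : Measure X)
    [IsProbabilityMeasure μ] {T : X → ℝ}
    (hT : Integrable (fun x => Real.exp (T x)) μ) {δ φ : X → ℝ} (hδ : Measurable δ)
    (hδ01 : ∀ x, δ x ∈ Set.Icc (0 : ℝ) 1) (hφm : Measurable φ) {τ : ℝ}
    (hφ : ∀ x, φ x = if T x > τ then 1 else 0)
    (hle : ∫ x, δ x ∂μ ≤ ∫ x, φ x ∂μ) :
    ∫ x, δ x ∂(μ.tilted T) ≤ ∫ x, φ x ∂(μ.tilted T) := by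
  have hφ01 : ∀ x, φ x ∈ Set.Icc (0 : ℝ) 1 := fun x => by
    rw [hφ]; split_ifs <;> simp
  have hb : ∀ {f : X → ℝ}, (∀ x, f x ∈ Set.Icc (0 : ℝ) 1) → ∀ x, ‖f x‖ ≤ 1 := fun h x => by
    rw [Real.norm_eq_abs, abs_le]; constructor <;> linarith [(h x).1, (h x).2]
  have hi : ∀ {f : X → ℝ}, Measurable f → (∀ x, f x ∈ Set.Icc (0 : ℝ) 1) → Integrable f μ :=
    fun hm h => Integrable.of_bound hm.aestronglyMeasurable 1 (Eventually.of_forall (hb h))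
  have hie : ∀ {f : X → ℝ}, Measurable f → (∀ x, f x ∈ Set.Icc (0 : ℝ) 1) →
      Integrable (fun x => Real.exp (T x) * f x) μ := fun hm h =>
    hT.mul_bdd (c := 1) hm.aestronglyMeasurable (Eventually.of_forall (hb h))
  -- Pointwise `(exp T - exp τ) (φ - δ) ≥ 0`: both factors change sign at `T = τ`.
  have key : ∫ x, Real.exp τ * (φ x - δ x) ∂μ ≤
      ∫ x, (Real.exp (T x) * φ x - Real.exp (T x) * δ x) ∂μ := by
    refine integral_mono (((hi hφm hφ01).sub (hi hδ hδ01)).const_mul _)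
      ((hie hφm hφ01).sub (hie hδ hδ01)) fun x => ?_
    change Real.exp τ * (φ x - δ x) ≤ Real.exp (T x) * φ x - Real.exp (T x) * δ x
    rw [← mul_sub, hφ]
    split_ifs with h
    · exact mul_le_mul_of_nonneg_right (Real.exp_le_exp.2 h.le) (by linarith [(hδ01 x).2])
    · exact mul_le_mul_of_nonpos_right (Real.exp_le_exp.2 (not_lt.1 h))
        (by linarith [(hδ01 x).1])
  rw [integral_const_mul, integral_sub (hi hφm hφ01) (hi hδ hδ01),
    integral_sub (hie hφm hφ01) (hie hδ hδ01)] at key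
  have h0 : 0 ≤ Real.exp τ * (∫ x, φ x ∂μ - ∫ x, δ x ∂μ) :=
    mul_nonneg (Real.exp_pos _).le (by linarith)
  simp only [integral_tilted, smul_eq_mul, div_mul_eq_mul_div, integral_div]
  have hZ : 0 ≤ ∫ x, Real.exp (T x) ∂μ := integral_nonneg fun x => (Real.exp_pos _).le
  exact div_le_div_of_nonneg_right (by linarith) hZ

variable (P)

/-- The centered difference of the truncated tangents. -/
noncomputable def truncDiff (g₀ g₁ : Lp ℝ 2 P) (n : ℕ) (x : Ω) : ℝ :=
  trunc g₁ n x - trunc g₀ n x - ∫ y, (trunc g₁ n y - trunc g₀ n y) ∂P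

variable {P}

theorem measurable_truncDiff (g₀ g₁ : Lp ℝ 2 P) (n : ℕ) : Measurable (truncDiff P g₀ g₁ n) :=
  ((measurable_trunc (measurable_Lp g₁) n).sub (measurable_trunc (measurable_Lp g₀) n)).sub_const _

theorem integrable_trunc (g : Lp ℝ 2 P) (n : ℕ) : Integrable (trunc g n) P :=
  ((Lp.memLp g).integrable (by norm_num)).abs.mono'
    (measurable_trunc (measurable_Lp g) n).aestronglyMeasurable
    (Eventually.of_forall fun x => abs_trunc_le g n x)

theorem integral_truncDiff (g₀ g₁ : Lp ℝ 2 P) (n : ℕ) : ∫ x, truncDiff P g₀ g₁ n x ∂P = 0 := by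
  unfold truncDiff
  rw [integral_sub (by exact (integrable_trunc g₁ n).sub (integrable_trunc g₀ n))
    (integrable_const _)]
  simp

theorem abs_truncDiff_le (g₀ g₁ : Lp ℝ 2 P) (n : ℕ) (x : Ω) :
    |truncDiff P g₀ g₁ n x| ≤ |g₁ x| + |g₀ x| + ∫ y, (|g₁ y| + |g₀ y|) ∂P := by
  have hb : ∀ y, |trunc g₁ n y - trunc g₀ n y| ≤ |g₁ y| + |g₀ y| := fun y =>
    (abs_sub _ _).trans (add_le_add (abs_trunc_le _ _ _) (abs_trunc_le _ _ _))
  refine (abs_sub _ _).trans (add_le_add (hb x) ?_)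
  have hi : Integrable (fun y => |g₁ y| + |g₀ y|) P :=
    ((Lp.memLp g₁).integrable (by norm_num)).abs.add ((Lp.memLp g₀).integrable (by norm_num)).abs
  exact norm_integral_le_of_norm_le (f := fun y => trunc g₁ n y - trunc g₀ n y) hi
    (Eventually.of_forall hb)

/-- The centring constant tends to the mean of `g₁ - g₀`, which is zero. Exact centring at each `n`
is still needed, since the limit theorem multiplies this mean by `√n`. -/
theorem tendsto_truncDiff {g₀ g₁ : Lp ℝ 2 P} (h₀ : g₀ ∈ tangents P) (h₁ : g₁ ∈ tangents P) :
    ∀ᵐ x ∂P, Tendsto (fun n => truncDiff P g₀ g₁ n x) atTop (𝓝 ((g₁ - g₀ : Lp ℝ 2 P) x)) := by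
  have i0 : Integrable g₀ P := (Lp.memLp g₀).integrable (by norm_num)
  have i1 : Integrable g₁ P := (Lp.memLp g₁).integrable (by norm_num)
  have hmean : Tendsto (fun n => ∫ y, (trunc g₁ n y - trunc g₀ n y) ∂P) atTop
      (𝓝 (∫ y, (g₁ y - g₀ y) ∂P)) := by
    refine tendsto_integral_of_dominated_convergence (fun y => |g₁ y| + |g₀ y|)
      (fun n => ((integrable_trunc g₁ n).sub (integrable_trunc g₀ n)).aestronglyMeasurable)
      (i1.abs.add i0.abs) (fun n => Eventually.of_forall fun y => ?_)
      (Eventually.of_forall fun y => (tendsto_trunc g₁ y).sub (tendsto_trunc g₀ y))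
    exact (abs_sub _ _).trans (add_le_add (abs_trunc_le _ _ _) (abs_trunc_le _ _ _))
  rw [integral_sub i1 i0, show ∫ y, g₀ y ∂P = 0 from h₀, show ∫ y, g₁ y ∂P = 0 from h₁,
    sub_zero] at hmean
  filter_upwards [Lp.coeFn_sub g₁ g₀] with x hx
  rw [hx, Pi.sub_apply]
  simpa [truncDiff] using ((tendsto_trunc g₁ x).sub (tendsto_trunc g₀ x)).sub hmean

/-- In the tilted model the sum tests are most powerful. -/
theorem rejectionProb_tilt_le (g₀ g₁ : Lp ℝ 2 P) {δ : (n : ℕ) → (Fin n → Ω) → ℝ}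
    (hδ : IsTest δ) (τ : ℝ) (n : ℕ)
    (h : rejectionProb (tilt P g₀) δ n ≤
      rejectionProb (tilt P g₀) (sumTest (truncDiff P g₀ g₁) τ) n) :
    rejectionProb (tilt P g₁) δ n ≤
      rejectionProb (tilt P g₁) (sumTest (truncDiff P g₀ g₁) τ) n := by
  set T : Ω → ℝ := fun x => scale n * trunc g₁ n x - scale n * trunc g₀ n x
  have m0 := measurable_trunc (measurable_Lp g₀) n
  have m1 := measurable_trunc (measurable_Lp g₁) n
  have hTm : Measurable T := by fun_prop
  have e1 : (tilt P g₁ n : Measure Ω) = (tilt P g₀ n : Measure Ω).tilted T := by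
    rw [coe_tilt, coe_tilt,
      tilted_tilted (integrable_exp_scale_mul_trunc P (measurable_Lp g₀) n)]
    congr 1
    ext x
    simp [T]
  have hTb : ∀ x, T x ≤ 2 := fun x => by
    have h0 := abs_le.1 (abs_scale_mul_trunc_le_one g₀ n x)
    have h1 := abs_le.1 (abs_scale_mul_trunc_le_one g₁ n x)
    simp only [T]
    linarith [h0.1, h1.2]
  have hTi : Integrable (fun x => Real.exp (T x)) (tilt P g₀ n : Measure Ω) :=
    Integrable.of_bound (by fun_prop) (Real.exp 2) (Eventually.of_forall fun x => by
      rw [Real.norm_eq_abs, Real.abs_exp]; exact Real.exp_le_exp.2 (hTb x))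
  have hST := isTest_sumTest (measurable_truncDiff g₀ g₁) τ n
  unfold rejectionProb at h ⊢
  rw [e1, pi_tilted _ hTi]
  have hSi : Integrable (fun x : Fin n → Ω => Real.exp (∑ i, T (x i)))
      (Measure.pi fun _ : Fin n => (tilt P g₀ n : Measure Ω)) := by
    simp only [Real.exp_sum]
    exact Integrable.fintype_prod (f := fun _ : Fin n => fun x => Real.exp (T x)) fun _ => hTi
  refine integral_tilted_le_of_integral_le _ hSi (hδ n).1 (hδ n).2 hST.1
    -- Undoing the centring of `truncDiff` shifts the critical value by a constant, so the sum test
    -- is a likelihood ratio test.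
    (τ := τ + scale n * (n * ∫ y, (trunc g₁ n y - trunc g₀ n y) ∂P)) (fun x => ?_) h
  have e2 : scale n * ∑ i, truncDiff P g₀ g₁ n (x i) =
      ∑ i, T (x i) - scale n * (n * ∫ y, (trunc g₁ n y - trunc g₀ n y) ∂P) := by
    simp only [truncDiff, T, Finset.sum_sub_distrib, mul_sub, Finset.mul_sum, Finset.sum_const,
      Finset.card_univ, Fintype.card_fin, nsmul_eq_mul]
  simp only [sumTest, e2, gt_iff_lt, lt_sub_iff_add_lt]

end Tilt

/-! ### The upper bound for the asymptotic power -/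

theorem Phi_strictMono : StrictMono Phi := by
  intro a b hab
  unfold Phi
  rw [cdf_eq_real, cdf_eq_real, ← Set.Iic_union_Ioc_eq_Iic hab.le,
    measureReal_union (Set.Iic_disjoint_Ioc le_rfl) measurableSet_Ioc]
  have hne : gaussianReal 0 1 (Set.Ioc a b) ≠ 0 := fun h => by
    have := gaussianReal_absolutelyContinuous' 0 one_ne_zero h
    exact hab.not_ge (by simpa using this)
  have : 0 < (gaussianReal 0 1).real (Set.Ioc a b) :=
    ENNReal.toReal_pos hne (measure_ne_top _ _)
  linarith

theorem tendsto_Phi_add (a : ℝ) : Tendsto (fun η => Phi (a + η)) (𝓝[>] 0) (𝓝 (Phi a)) := by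
  have h : Tendsto Phi (𝓝[≥] a) (𝓝 (Phi a)) := (cdf (gaussianReal 0 1)).right_continuous a
  refine h.comp (tendsto_nhdsWithin_iff.2 ⟨?_, ?_⟩)
  · have : Tendsto (fun η : ℝ => a + η) (𝓝 0) (𝓝 (a + 0)) :=
      (continuous_const.add continuous_id).tendsto 0
    rw [add_zero] at this
    exact this.mono_left nhdsWithin_le_nhds
  · filter_upwards [self_mem_nhdsWithin] with η hη
    exact le_add_of_nonneg_right (Set.mem_Ioi.1 hη).le

theorem rejectionProb_mem_Icc (Q : ℕ → ProbabilityMeasure Ω) {δ : (n : ℕ) → (Fin n → Ω) → ℝ}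
    (hδ : IsTest δ) (n : ℕ) : rejectionProb Q δ n ∈ Set.Icc (0 : ℝ) 1 := by
  refine ⟨integral_nonneg fun x => ((hδ n).2 x).1, ?_⟩
  have := integral_mono_of_nonneg (μ := Measure.pi fun _ : Fin n => (Q n : Measure Ω))
    (Eventually.of_forall fun x => ((hδ n).2 x).1) (integrable_const 1)
    (Eventually.of_forall fun x => ((hδ n).2 x).2)
  simpa [rejectionProb] using this

theorem isBoundedUnder_le_rejectionProb (Q : ℕ → ProbabilityMeasure Ω)
    {δ : (n : ℕ) → (Fin n → Ω) → ℝ} (hδ : IsTest δ) :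
    IsBoundedUnder (· ≤ ·) atTop (rejectionProb Q δ) :=
  isBoundedUnder_of ⟨1, fun n => (rejectionProb_mem_Icc Q hδ n).2⟩

theorem isBoundedUnder_ge_rejectionProb (Q : ℕ → ProbabilityMeasure Ω)
    {δ : (n : ℕ) → (Fin n → Ω) → ℝ} (hδ : IsTest δ) :
    IsBoundedUnder (· ≥ ·) atTop (rejectionProb Q δ) :=
  isBoundedUnder_of ⟨0, fun n => (rejectionProb_mem_Icc Q hδ n).1⟩

theorem asympSize_le_one (Q : ℕ → ProbabilityMeasure Ω) {δ : (n : ℕ) → (Fin n → Ω) → ℝ}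
    (hδ : IsTest δ) : asympSize Q δ ≤ 1 :=
  limsup_le_of_le (isBoundedUnder_ge_rejectionProb Q hδ).isCoboundedUnder_le
    (Eventually.of_forall fun n => (rejectionProb_mem_Icc Q hδ n).2)

theorem asympPower_nonneg (Q : ℕ → ProbabilityMeasure Ω) {δ : (n : ℕ) → (Fin n → Ω) → ℝ}
    (hδ : IsTest δ) : 0 ≤ asympPower Q δ :=
  le_liminf_of_le (isBoundedUnder_le_rejectionProb Q hδ).isCoboundedUnder_ge
    (Eventually.of_forall fun n => (rejectionProb_mem_Icc Q hδ n).1)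

variable {P : Measure Ω} [IsProbabilityMeasure P]

theorem tendsto_rejectionProb_truncDiff {g g₀ g₁ : Lp ℝ 2 P} (hg : g ∈ tangents P)
    (h₀ : g₀ ∈ tangents P) (h₁ : g₁ ∈ tangents P) (hne : g₁ - g₀ ≠ 0) (τ : ℝ) :
    Tendsto (rejectionProb (tilt P g) (sumTest (truncDiff P g₀ g₁) τ)) atTop
      (𝓝 (Phi ((inner ℝ (g₁ - g₀) g - τ) / ‖g₁ - g₀‖))) :=
  tendsto_rejectionProb_sumTest (isLocalAlternative_tilt hg) (measurable_truncDiff g₀ g₁)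
    (H := fun x => |g₁ x| + |g₀ x| + ∫ y, (|g₁ y| + |g₀ y|) ∂P)
    (((Lp.memLp g₁).abs.add (Lp.memLp g₀).abs).add (memLp_const _))
    (fun n => Eventually.of_forall (abs_truncDiff_le g₀ g₁ n)) (tendsto_truncDiff h₀ h₁)
    (integral_truncDiff g₀ g₁) hne τ

/-- The asymptotic power bound for the simple problem `g₀` vs. `g₁`. -/
theorem asympPower_le {g₀ g₁ : Lp ℝ 2 P} (h₀ : g₀ ∈ tangents P) (h₁ : g₁ ∈ tangents P)
    (hne : g₁ - g₀ ≠ 0) {Q₀ Q₁ : ℕ → ProbabilityMeasure Ω} (hQ₀ : IsLocalAlternative P g₀ Q₀)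
    (hQ₁ : IsLocalAlternative P g₁ Q₁) {δ : (n : ℕ) → (Fin n → Ω) → ℝ} (hδ : IsTest δ) {u : ℝ}
    (hsize : asympSize Q₀ δ ≤ Phi (-u)) : asympPower Q₁ δ ≤ Phi (-u + ‖g₁ - g₀‖) := by
  have hK : 0 < ‖g₁ - g₀‖ := norm_pos_iff.2 hne
  refine ge_of_tendsto (tendsto_Phi_add (-u + ‖g₁ - g₀‖)) ?_
  filter_upwards [self_mem_nhdsWithin] with η hη
  replace hη : 0 < η := hη
  -- The critical point `u - η` gives the comparison test an asymptotic size strictly above `Φ(-u)`.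
  -- Hence for large `n` it has larger size than `δ` and, by Neyman–Pearson, at least its power. The
  -- slack `η` tends to zero at the end, where right continuity of `Phi` suffices.
  set τ := inner ℝ (g₁ - g₀) g₀ + ‖g₁ - g₀‖ * (u - η) with hτ
  set S := sumTest (truncDiff P g₀ g₁) τ
  have hS0 : Tendsto (rejectionProb (tilt P g₀) S) atTop (𝓝 (Phi (-u + η))) := by
    convert tendsto_rejectionProb_truncDiff h₀ h₀ h₁ hne τ using 3
    rw [hτ]; field_simp; ring
  have hS1 : Tendsto (rejectionProb (tilt P g₁) S) atTop (𝓝 (Phi (-u + ‖g₁ - g₀‖ + η))) := by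
    convert tendsto_rejectionProb_truncDiff h₁ h₀ h₁ hne τ using 3
    have : inner ℝ (g₁ - g₀) g₁ = inner ℝ (g₁ - g₀) g₀ + ‖g₁ - g₀‖ ^ 2 := by
      rw [← real_inner_self_eq_norm_sq, ← inner_add_right, add_sub_cancel]
    rw [hτ, this]; field_simp; ring
  obtain ⟨ε₀, hε₀, hle₀⟩ := hQ₀.exists_abs_sub_le (isLocalAlternative_tilt h₀)
    (tilt_absolutelyContinuous P g₀)
  obtain ⟨ε₁, hε₁, hle₁⟩ := hQ₁.exists_abs_sub_le (isLocalAlternative_tilt h₁)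
    (tilt_absolutelyContinuous P g₁)
  -- The gap is shared by three errors: the limsup of the size of `δ`, the change of laws `ε₀`, and
  -- the convergence of the size of `S`.
  set d := Phi (-u + η) - Phi (-u) with hd
  have hd0 : 0 < d := sub_pos.2 (Phi_strictMono (by linarith))
  have hlt : ∀ᶠ n in atTop, rejectionProb Q₀ δ n < Phi (-u) + d / 3 :=
    eventually_lt_of_limsup_lt (lt_of_le_of_lt hsize (by linarith))
      (isBoundedUnder_le_rejectionProb Q₀ hδ)
  have hev : ∀ᶠ n in atTop, rejectionProb Q₁ δ n ≤ rejectionProb (tilt P g₁) S n + ε₁ n := by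
    filter_upwards [hlt, hε₀.eventually_lt_const (show 0 < d / 3 by linarith),
      hS0.eventually_const_lt (show Phi (-u + η) - d / 3 < Phi (-u + η) by linarith)]
      with n hn1 hn2 hn3
    have a0 := abs_le.1 (hle₀ δ hδ n)
    have a1 := abs_le.1 (hle₁ δ hδ n)
    have := rejectionProb_tilt_le g₀ g₁ hδ τ n (by linarith [a0.2])
    linarith [a1.1]
  have hlim : Tendsto (fun n => rejectionProb (tilt P g₁) S n + ε₁ n) atTop
      (𝓝 (Phi (-u + ‖g₁ - g₀‖ + η))) := by simpa using hS1.add hε₁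
  rw [← hlim.liminf_eq]
  exact liminf_le_liminf hev (isBoundedUnder_ge_rejectionProb Q₁ hδ)
    hlim.isBoundedUnder_le.isCoboundedUnder_ge

/-! ### The optimal test -/

theorem isTest_optTest (u : ℝ) (q : Lp ℝ 2 P × Lp ℝ 2 P) : IsTest (optTest u q) :=
  isTest_sumTest (k := fun _ => (q.2 - q.1 : Lp ℝ 2 P)) (fun _ => measurable_Lp _) _

theorem tendsto_rejectionProb_optTest {g : Lp ℝ 2 P} {Q : ℕ → ProbabilityMeasure Ω}
    (hQ : IsLocalAlternative P g Q) {q : Lp ℝ 2 P × Lp ℝ 2 P} (h₀ : q.1 ∈ tangents P)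
    (h₁ : q.2 ∈ tangents P) (hne : q.2 - q.1 ≠ 0) (u : ℝ) :
    Tendsto (rejectionProb Q (optTest u q)) atTop
      (𝓝 (Phi (-u + (inner ℝ (q.2 - q.1) g - inner ℝ (q.2 - q.1) q.1) / ‖q.2 - q.1‖))) := by
  have hK : 0 < ‖q.2 - q.1‖ := norm_pos_iff.2 hne
  have hmean : ∫ x, (q.2 - q.1 : Lp ℝ 2 P) x ∂P = 0 := by
    rw [integral_congr_ae (Lp.coeFn_sub q.2 q.1)]
    simp only [Pi.sub_apply]
    rw [integral_sub ((Lp.memLp q.2).integrable (by norm_num))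
      ((Lp.memLp q.1).integrable (by norm_num)), show ∫ x, q.1 x ∂P = 0 from h₀,
      show ∫ x, q.2 x ∂P = 0 from h₁, sub_zero]
  have := tendsto_rejectionProb_sumTest (k := fun _ => (q.2 - q.1 : Lp ℝ 2 P)) hQ
    (fun _ => measurable_Lp _) (Lp.memLp (q.2 - q.1)).abs
    (fun _ => Eventually.of_forall fun _ => le_rfl)
    (Eventually.of_forall fun _ => tendsto_const_nhds) (fun _ => hmean) hne
    (‖q.2 - q.1‖ * u + inner ℝ (q.2 - q.1) q.1)
  have e : -u + (inner ℝ (q.2 - q.1) g - inner ℝ (q.2 - q.1) q.1) / ‖q.2 - q.1‖ =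
      (inner ℝ (q.2 - q.1) g - (‖q.2 - q.1‖ * u + inner ℝ (q.2 - q.1) q.1)) / ‖q.2 - q.1‖ := by
    field_simp; ring
  rw [e]
  exact this

/-! ### Elements of minimum norm -/

/-- An element of minimum norm is the projection of `0` onto `G`; this is the variational inequality
for that projection. -/
theorem IsMinNorm.inner_nonneg {G : Set (Lp ℝ 2 P)} (hG : Convex ℝ G) {h : Lp ℝ 2 P}
    (hh : IsMinNorm G h) {k : Lp ℝ 2 P} (hk : k ∈ G) : 0 ≤ inner ℝ h (k - h) := by
  have : Nonempty G := ⟨⟨h, hh.1⟩⟩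
  have heq : ‖(0 : Lp ℝ 2 P) - h‖ = ⨅ w : G, ‖(0 : Lp ℝ 2 P) - w‖ := by
    refine le_antisymm (le_ciInf fun w => ?_) (ciInf_le ⟨0, ?_⟩ (⟨h, hh.1⟩ : G))
    · simpa using hh.2 w w.2
    · rintro _ ⟨w, rfl⟩; exact norm_nonneg _
  have := (norm_eq_iInf_iff_real_inner_le_zero hG hh.1).1 heq k hk
  rw [zero_sub, inner_neg_left] at this
  linarith

theorem existsUnique_isMinNorm {G : Set (Lp ℝ 2 P)} (hG : Convex ℝ G) (hne : G.Nonempty)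
    (hcl : IsClosed G) : ∃! h, IsMinNorm G h := by
  obtain ⟨h, hh, heq⟩ := exists_norm_eq_iInf_of_complete_convex hne hcl.isComplete hG 0
  have hmin : IsMinNorm G h := by
    refine ⟨hh, fun k hk => ?_⟩
    have := ciInf_le (f := fun w : G => ‖(0 : Lp ℝ 2 P) - w‖)
      ⟨0, by rintro _ ⟨w, rfl⟩; exact norm_nonneg _⟩ ⟨k, hk⟩
    rw [← heq] at this
    simpa using this
  refine ⟨h, hmin, fun k hk => ?_⟩
  have h1 := hmin.inner_nonneg hG hk.1
  have h2 := hk.inner_nonneg hG hh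
  -- Adding the variational inequalities of two minimizers gives `‖k - h‖² ≤ 0`.
  have h3 : inner ℝ (k - h) (k - h) = -(inner ℝ h (k - h) + inner ℝ k (h - k)) := by
    simp only [inner_sub_left, inner_sub_right]; ring
  have h4 : inner ℝ (k - h) (k - h) ≤ 0 := by linarith
  rw [real_inner_self_eq_norm_sq] at h4
  exact sub_eq_zero.1 (norm_eq_zero.1 (pow_eq_zero_iff two_ne_zero |>.1 (h4.antisymm (sq_nonneg _))))

/-! ### The least favourable pair: saddle point and maxmin power -/

section MinPair

variable {G₀ G₁ : Set (Lp ℝ 2 P)} {q : Lp ℝ 2 P × Lp ℝ 2 P}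

/-- The variational inequality is tested on `q.2 - h`, moving only the first component. This puts
the maximal asymptotic size of `δ_q` over `G₀` at `q.1`. -/
theorem IsMinNorm.inner_fst_le (hmin : IsMinNorm (G₁ - G₀) (q.2 - q.1)) (hc : Convex ℝ (G₁ - G₀))
    (hq : q ∈ G₀ ×ˢ G₁) {h : Lp ℝ 2 P} (hh : h ∈ G₀) :
    inner ℝ (q.2 - q.1) h ≤ inner ℝ (q.2 - q.1) q.1 := by
  have := hmin.inner_nonneg hc (Set.sub_mem_sub hq.2 hh)
  rw [sub_sub_sub_cancel_left, inner_sub_right] at this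
  linarith

theorem IsMinNorm.le_inner_snd (hmin : IsMinNorm (G₁ - G₀) (q.2 - q.1)) (hc : Convex ℝ (G₁ - G₀))
    (hq : q ∈ G₀ ×ˢ G₁) {h : Lp ℝ 2 P} (hh : h ∈ G₁) :
    inner ℝ (q.2 - q.1) q.1 + ‖q.2 - q.1‖ ^ 2 ≤ inner ℝ (q.2 - q.1) h := by
  have := hmin.inner_nonneg hc (Set.sub_mem_sub hh hq.1)
  rw [sub_sub_sub_cancel_right, inner_sub_right] at this
  rw [← real_inner_self_eq_norm_sq, ← inner_add_right, add_sub_cancel]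
  linarith

theorem asympSize_optTest_le (hG₀ : G₀ ⊆ tangents P) (hG₁ : G₁ ⊆ tangents P)
    (hmin : IsMinNorm (G₁ - G₀) (q.2 - q.1)) (hc : Convex ℝ (G₁ - G₀)) (hq : q ∈ G₀ ×ˢ G₁)
    (hne : q.2 - q.1 ≠ 0) (u : ℝ) {h : Lp ℝ 2 P} (hh : h ∈ G₀) {Q : ℕ → ProbabilityMeasure Ω}
    (hQ : IsLocalAlternative P h Q) : asympSize Q (optTest u q) ≤ Phi (-u) := by
  rw [asympSize,
    (tendsto_rejectionProb_optTest hQ (hG₀ hq.1) (hG₁ hq.2) hne u).limsup_eq]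
  refine Phi_strictMono.monotone (add_le_of_nonpos_right ?_)
  exact div_nonpos_of_nonpos_of_nonneg (sub_nonpos.2 (hmin.inner_fst_le hc hq hh))
    (norm_nonneg _)

theorem le_asympPower_optTest (hG₀ : G₀ ⊆ tangents P) (hG₁ : G₁ ⊆ tangents P)
    (hmin : IsMinNorm (G₁ - G₀) (q.2 - q.1)) (hc : Convex ℝ (G₁ - G₀)) (hq : q ∈ G₀ ×ˢ G₁)
    (hne : q.2 - q.1 ≠ 0) (u : ℝ) {h : Lp ℝ 2 P} (hh : h ∈ G₁) {Q : ℕ → ProbabilityMeasure Ω}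
    (hQ : IsLocalAlternative P h Q) :
    Phi (-u + ‖q.2 - q.1‖) ≤ asympPower Q (optTest u q) := by
  rw [asympPower,
    (tendsto_rejectionProb_optTest hQ (hG₀ hq.1) (hG₁ hq.2) hne u).liminf_eq]
  refine Phi_strictMono.monotone (add_le_add_right ?_ _)
  rw [le_div_iff₀ (norm_pos_iff.2 hne), ← sq]
  linarith [hmin.le_inner_snd hc hq hh]

theorem isSaddle_optTest (hG₀ : G₀ ⊆ tangents P) (hG₁ : G₁ ⊆ tangents P)
    (hmin : IsMinNorm (G₁ - G₀) (q.2 - q.1)) (hc : Convex ℝ (G₁ - G₀)) (hq : q ∈ G₀ ×ˢ G₁)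
    (hne : q.2 - q.1 ≠ 0) {Q : Lp ℝ 2 P → ℕ → ProbabilityMeasure Ω}
    (hQ : ∀ g ∈ G₀ ∪ G₁, IsLocalAlternative P g (Q g)) (u : ℝ) :
    IsSaddle (Phi (-u)) Q G₀ G₁ q (optTest u q) := by
  -- `IsSaddlePointOn` compares the payoff of `q` and `δ` with that of `h` and `δ_q` in one
  -- inequality; the value `Φ(-u + ‖q₁₀‖)` separates the two. Tests violating the level at `q` have
  -- payoff `⊥`.
  refine ⟨hq, isTest_optTest u q, fun h hh δ hδ => ?_⟩
  have hsize := asympSize_optTest_le hG₀ hG₁ hmin hc hq hne u hh.1 (hQ _ (Or.inl hh.1))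
  have hpow := le_asympPower_optTest hG₀ hG₁ hmin hc hq hne u hh.2 (hQ _ (Or.inr hh.2))
  unfold payoff
  rw [if_pos hsize]
  split_ifs with hδs
  · exact EReal.coe_le_coe_iff.2 ((asympPower_le (hG₀ hq.1) (hG₁ hq.2) hne (hQ _ (Or.inl hq.1))
      (hQ _ (Or.inr hq.2)) hδ hδs).trans hpow)
  · exact bot_le

theorem isGreatest_minPower (hG₀ : G₀ ⊆ tangents P) (hG₁ : G₁ ⊆ tangents P)
    (hmin : IsMinNorm (G₁ - G₀) (q.2 - q.1)) (hc : Convex ℝ (G₁ - G₀)) (hq : q ∈ G₀ ×ˢ G₁)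
    (hne : q.2 - q.1 ≠ 0) {Q : Lp ℝ 2 P → ℕ → ProbabilityMeasure Ω}
    (hQ : ∀ g ∈ G₀ ∪ G₁, IsLocalAlternative P g (Q g)) (u : ℝ) :
    IsGreatest (minPower Q G₁ '' levelTests (Phi (-u)) Q G₀) (Phi (-u + ‖q.2 - q.1‖)) ∧
      optTest u q ∈ levelTests (Phi (-u)) Q G₀ ∧
      minPower Q G₁ (optTest u q) = Phi (-u + ‖q.2 - q.1‖) := by
  have : Nonempty G₀ := ⟨⟨q.1, hq.1⟩⟩
  have : Nonempty G₁ := ⟨⟨q.2, hq.2⟩⟩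
  have hlevel : optTest u q ∈ levelTests (Phi (-u)) Q G₀ :=
    ⟨isTest_optTest u q, ciSup_le fun h =>
      asympSize_optTest_le hG₀ hG₁ hmin hc hq hne u h.2 (hQ _ (Or.inl h.2))⟩
  have hup : ∀ δ ∈ levelTests (Phi (-u)) Q G₀, minPower Q G₁ δ ≤ Phi (-u + ‖q.2 - q.1‖) := by
    rintro δ ⟨hδ, hs⟩
    -- A real supremum bounds its terms only for families bounded above; here 1 is a bound.
    have h1 : asympSize (Q q.1) δ ≤ Phi (-u) := (le_ciSup (f := fun g : G₀ => asympSize (Q g) δ)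
      ⟨1, by rintro _ ⟨g, rfl⟩; exact asympSize_le_one _ hδ⟩ ⟨q.1, hq.1⟩).trans hs
    have h2 : minPower Q G₁ δ ≤ asympPower (Q q.2) δ :=
      ciInf_le (f := fun g : G₁ => asympPower (Q g) δ)
        ⟨0, by rintro _ ⟨g, rfl⟩; exact asympPower_nonneg _ hδ⟩ ⟨q.2, hq.2⟩
    exact h2.trans (asympPower_le (hG₀ hq.1) (hG₁ hq.2) hne (hQ _ (Or.inl hq.1))
      (hQ _ (Or.inr hq.2)) hδ h1)
  have hval : minPower Q G₁ (optTest u q) = Phi (-u + ‖q.2 - q.1‖) :=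
    le_antisymm (hup _ hlevel) (le_ciInf fun h =>
      le_asympPower_optTest hG₀ hG₁ hmin hc hq hne u h.2 (hQ _ (Or.inr h.2)))
  refine ⟨⟨⟨_, hlevel, hval⟩, ?_⟩, hlevel, hval⟩
  rintro _ ⟨δ, hδ, rfl⟩
  exact hup δ hδ

/-- Both `g.1` and `q.1` maximize the inner product with the common difference over `G₀`, so the
critical values agree. -/
theorem optTest_eq_of_sub_eq (hmin : IsMinNorm (G₁ - G₀) (q.2 - q.1)) (hc : Convex ℝ (G₁ - G₀))
    (hq : q ∈ G₀ ×ˢ G₁) {g : Lp ℝ 2 P × Lp ℝ 2 P} (hg : g ∈ G₀ ×ˢ G₁)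
    (heq : g.2 - g.1 = q.2 - q.1) (u : ℝ) : optTest u g = optTest u q := by
  have h1 := hmin.inner_fst_le hc hq hg.1
  have h2 := (heq ▸ hmin : IsMinNorm (G₁ - G₀) (g.2 - g.1)).inner_fst_le hc hg hq.1
  rw [heq] at h2
  ext n x
  simp only [optTest, heq, le_antisymm h1 h2]

end MinPair

end AsympTest

theorem mainTheorem1 {Ω : Type*} [MeasurableSpace Ω] (P : Measure Ω) [IsProbabilityMeasure P]
    (G₀ G₁ : Set (Lp ℝ 2 P))
    (hG₀ : G₀ ⊆ AsympTest.tangents P) (hG₁ : G₁ ⊆ AsympTest.tangents P)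
    (hne₀ : G₀.Nonempty) (hne₁ : G₁.Nonempty) (hdisj : Disjoint G₀ G₁)
    (hcl₀ : IsClosed G₀) (hcl₁ : IsClosed G₁)
    (hconv₀ : Convex ℝ G₀) (hconv₁ : Convex ℝ G₁)
    (hcl₁₀ : IsClosed (G₁ - G₀))
    -- the laws `P_{n,g}` of the single observations
    (Q : Lp ℝ 2 P → ℕ → ProbabilityMeasure Ω)
    (hQ : ∀ g ∈ G₀ ∪ G₁, AsympTest.IsLocalAlternative P g (Q g))
    (α : ℝ) (hα : α ∈ Set.Ioo (0 : ℝ) 1)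
    -- `u` is the standard normal upper `α` point
    (u : ℝ) (hu : AsympTest.Phi (-u) = α) :
    (∃! h : Lp ℝ 2 P, AsympTest.IsMinNorm (G₁ - G₀) h) ∧
    ∀ q ∈ G₀ ×ˢ G₁, AsympTest.IsMinNorm (G₁ - G₀) (q.2 - q.1) →
      -- `(q, δ_q)` is a saddle point
      AsympTest.IsSaddle α Q G₀ G₁ q (AsympTest.optTest u q) ∧
      -- the maxmin asymptotic power, attained by the test `δ_q`
      IsGreatest (AsympTest.minPower Q G₁ '' AsympTest.levelTests α Q G₀)
        (AsympTest.Phi (-u + ‖q.2 - q.1‖)) ∧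
      AsympTest.optTest u q ∈ AsympTest.levelTests α Q G₀ ∧
      AsympTest.minPower Q G₁ (AsympTest.optTest u q) = AsympTest.Phi (-u + ‖q.2 - q.1‖) ∧
      -- any other pair with the same difference
      ∀ g ∈ G₀ ×ˢ G₁, g.2 - g.1 = q.2 - q.1 →
        AsympTest.IsSaddle α Q G₀ G₁ g (AsympTest.optTest u g) ∧
        AsympTest.optTest u g = AsympTest.optTest u q := by
  have hc : Convex ℝ (G₁ - G₀) := hconv₁.sub hconv₀
  subst hu
  refine ⟨AsympTest.existsUnique_isMinNorm hc (hne₁.sub hne₀) hcl₁₀, fun q hq hmin => ?_⟩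
  -- Disjointness excludes the degenerate case of zero limiting variance.
  have hne : q.2 - q.1 ≠ 0 := fun h =>
    Set.disjoint_left.1 hdisj hq.1 (sub_eq_zero.1 h ▸ hq.2)
  obtain ⟨h1, h2, h3⟩ := AsympTest.isGreatest_minPower hG₀ hG₁ hmin hc hq hne hQ u
  refine ⟨AsympTest.isSaddle_optTest hG₀ hG₁ hmin hc hq hne hQ u, h1, h2, h3,
    fun g hg heq => ⟨?_, AsympTest.optTest_eq_of_sub_eq hmin hc hq hg heq u⟩⟩
  exact AsympTest.isSaddle_optTest hG₀ hG₁ (heq ▸ hmin) hc hg (heq ▸ hne) hQ u
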